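/- **Model.** Let $x\in\{0,1\}^k$ be unknown. A parity query draws a degree $d$ from a distribution $(\Omega_1,\dots,\Omega_k)$, then a uniformly random $d$-subset of the $k$ variables, and returns the XOR of these variables; $n$ independent queries are answered. The query difficulty is $\bar d=\sum_{d=1}^k d\,\Omega_d$. The *soliton distribution* with maximum degree $D$ is $\Omega_1=1/D$, $\Omega_d=\frac1{d(d-1)}$ for $2\le d\le D$, and $\Omega_d=0$ for $d>D$. The *adjusted soliton distribution* with parameters $D,\eta$ is $\Omega'_1=1-\eta+\eta/D$, $\Omega'_d=\frac{\eta}{d(d-1)}$ for $2\le d\le D$, and $\Omega'_d=0$ for $d>D$. The *BP (peeling) decoder* works on the bipartite graph between variables and queries. It first covers (learns) each variable that is the only neighbor of some query. At each step it processes one covered unprocessed variable: it XORs its value to all queries connected to it, removes the variable with its edges, and covers each variable that is now the only remaining neighbor of some query. It stops when no covered unprocessed variable is left. BP *recovers a fraction $1-\delta$ with high probability* if the probability that it recovers fewer than $(1-\delta)k$ variables, maximized over $x$, tends to $0$ as $k\to\infty$. Let $P^{(k)}_{e,1-\delta}=\min_{\hat x}\max_x\Pr\big(\tfrac1k\#\{i:\hat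 x_i=x_i\}<1-\delta\big)$, where the estimators $\hat x$ know the queries and their answers. **Theorem.** There is a universal constant $c>0$ such that the following two statements hold for every sequence $\delta=\delta_k\to0$ with $\delta\ge 1/k$. 1. (Soliton distribution.) Let the degrees follow the soliton distribution with maximum degree $D=D_k\in\{2,\dots,k\}$, so that $\bar d=\sum_{d=1}^D 1/d>1$, and let $n\ge c\max\big\{k,\frac{k\log(1/\delta)}{\bar d-1}\big\}$. Then $P^{(k)}_{e,1-\delta}\to0$. If moreover $D=o(k)$, then BP recovers a fraction $1-\delta$ with high probability. 2. (Adjusted soliton distribution.) Let $1<\bar d=\bar d_k<\log(1/\delta)$, let $D=\lfloor 1/\delta\rfloor$, and let the degrees follow the adjusted soliton distribution with the $\eta$ for which the query difficulty equals $\bar d$. If $n\ge c\max\big\{k,\frac{k\log(1/\delta)}{\bar d-1}\big\}$, then BP recovers a fraction $1-\delta$ with high probability. Moreover, if $\bar d=1$ (every query has degree $1$), then for every $\epsilon>0$, every $\delta\to0$ with $\delta\ge1/k$, and every $n\ge(1+\epsilon)k\log(1/\delta)$, BP recovers a fraction $1-\delta$ with high probability. -/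

import Mathlib

open Filter Topology

/-- The soliton degree distribution with maximum degree `D`: `Ω_1 = 1/D`,
`Ω_d = 1/(d(d-1))` for `2 ≤ d ≤ D`, and `Ω_d = 0` otherwise. -/
noncomputable def soliton (D : ℕ) (d : ℕ) : ℝ :=
  if d = 1 then 1 / (D : ℝ)
  else if 2 ≤ d ∧ d ≤ D then 1 / ((d : ℝ) * ((d : ℝ) - 1))
  else 0

/-- The adjusted soliton distribution: the mixture of the unit mass at degree `1`
(weight `1 - η`) and of the soliton distribution with maximum degree `D` (weight `η`). -/
noncomputable def adjustedSoliton (D : ℕ) (η : ℝ) (d : ℕ) : ℝ :=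
  if d = 1 then 1 - η + η / (D : ℝ)
  else if 2 ≤ d ∧ d ≤ D then η / ((d : ℝ) * ((d : ℝ) - 1))
  else 0

/-- The degree distribution for which every query has degree `1`. -/
noncomputable def unitDegree (d : ℕ) : ℝ := if d = 1 then 1 else 0

/-- The query difficulty `∑_{d=1}^k d Ω_d`. -/
noncomputable def queryDifficulty (Ω : ℕ → ℝ) (k : ℕ) : ℝ :=
  ∑ d ∈ Finset.Icc 1 k, (d : ℝ) * Ω d

/-- A design of `n` parity queries on `k` variables: the `a`-th query asks for the parity of
the variables in `G a`.  It is the bipartite graph between input and output nodes. -/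
abbrev Design (k n : ℕ) : Type := Fin n → Finset (Fin k)

/-- Probability that one query asks for the subset `T`: the degree `|T|` is drawn from `Ω`
and then `T` is uniform among the subsets of that size. -/
noncomputable def queryProb (Ω : ℕ → ℝ) {k : ℕ} (T : Finset (Fin k)) : ℝ :=
  Ω T.card / (k.choose T.card : ℝ)

open Classical in
/-- Probability of the event `E` when the `n` queries are independent with degree
distribution `Ω`. -/
noncomputable def designProb (Ω : ℕ → ℝ) {k n : ℕ} (E : Design k n → Prop) : ℝ :=
  ∑ G : Design k n with E G, ∏ a, queryProb Ω (G a)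

/-- The answers to the queries: the XOR (sum in `ZMod 2`) of the queried variables. -/
def answers {k n : ℕ} (G : Design k n) (x : Fin k → ZMod 2) : Fin n → ZMod 2 :=
  fun a => ∑ i ∈ G a, x i

/-- The fraction of common components of two binary vectors. -/
noncomputable def agreement {k : ℕ} (x z : Fin k → ZMod 2) : ℝ :=
  ((Finset.univ.filter fun i => x i = z i).card : ℝ) / (k : ℝ)

/-- The error probability for almost exact recovery of an `α` fraction, minimized over all
estimators (which see the design and the answers), for the worst vector `x`. -/
noncomputable def optimalError (Ω : ℕ → ℝ) (k n : ℕ) (α : ℝ) : ℝ :=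
  ⨅ xhat : Design k n → (Fin n → ZMod 2) → Fin k → ZMod 2,
    ⨆ x : Fin k → ZMod 2,
      designProb Ω fun G : Design k n => agreement x (xhat G (answers G x)) < α

/-- State of the BP (peeling) decoder. -/
structure BPState (k n : ℕ) where
  /-- values of the covered input nodes (`none` for an uncovered node) -/
  est : Fin k → Option (ZMod 2)
  /-- input nodes that have been processed, and so removed from the graph -/
  processed : Finset (Fin k)
  /-- remaining neighbors of each output node -/
  nbr : Fin n → Finset (Fin k)
  /-- current value of each output node -/
  par : Fin n → ZMod 2

namespace BPState

open Classical in
/-- Every uncovered input node that is the only remaining neighbor of some output node becomes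
covered, with the value of that output node. -/
noncomputable def cover {k n : ℕ} (s : BPState k n) : BPState k n where
  est := fun i =>
    match s.est i with
    | some v => some v
    | none => if h : ∃ a, s.nbr a = {i} then some (s.par h.choose) else none
  processed := s.processed
  nbr := s.nbr
  par := s.par

/-- The initial state: all input nodes are uncovered. -/
def init {k n : ℕ} (G : Design k n) (y : Fin n → ZMod 2) : BPState k n where
  est := fun _ => none
  processed := ∅
  nbr := G
  par := y

/-- The covered input nodes that have not yet been processed. -/
def ripple {k n : ℕ} (s : BPState k n) : Finset (Fin k) :=
  Finset.univ.filter fun i => (s.est i).isSome = true ∧ i ∉ s.processed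

/-- Processing an input node: its value is XORed to all connected output nodes, then the node
and its edges are removed. -/
def process {k n : ℕ} (s : BPState k n) (i : Fin k) : BPState k n where
  est := s.est
  processed := insert i s.processed
  nbr := fun a => (s.nbr a).erase i
  par := fun a => if i ∈ s.nbr a then s.par a + (s.est i).getD 0 else s.par a

open Classical in
/-- One step: process one covered, unprocessed input node (the one of least index) and cover the
neighbors of the output nodes of degree one; stop if there is no such input node. -/
noncomputable def step {k n : ℕ} (s : BPState k n) : BPState k n :=
  if h : s.ripple.Nonempty then (s.process (s.ripple.min' h)).cover else s

end BPState

/-- The output of the BP decoder.  Each effective step processes a new input node, so the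
decoder has stopped after `k` steps. -/
noncomputable def bpDecode {k n : ℕ} (G : Design k n) (y : Fin n → ZMod 2) :
    Fin k → Option (ZMod 2) :=
  (BPState.step^[k] (BPState.init G y).cover).est

/-- The probability that the BP decoder recovers fewer than `α k` of the `k` variables, for the
worst vector `x`.  A variable counts as recovered when it is covered with its true value. -/
noncomputable def bpError (Ω : ℕ → ℝ) (k n : ℕ) (α : ℝ) : ℝ :=
  ⨆ x : Fin k → ZMod 2,
    designProb Ω fun G : Design k n =>
      ((Finset.univ.filter fun i => bpDecode G (answers G x) i = some (x i)).card : ℝ)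
        < α * (k : ℝ)

/-!
All bounds are union bounds over sets of variables.

*BP.*  Let `P` be the set of variables that BP recovers and `W` its complement.  BP never assigns a
wrong value, so it fails only if `W` has more than `δ k` elements, and when it stops

* no query meets `W` in exactly one variable (`card_inter_compl_bpRecovered_ne_one`);
* at least `|P|` queries are nonempty and contained in `P`, because each variable of `P` was
  released by a query of its own (`exists_queries_subset_bpRecovered`).

The soliton distribution is the adjusted one with `η = 1`; let `Ω₁` be its weight at degree one.

If `W` has at most half of the variables, the first property suffices.  With `w = |W|`, a query
meets `W` in exactly one variable with probability of order `η (w / k) H_M`, where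
`M = min (D - 1) (k / (2 w))`, because each degree `d ≤ M + 1` contributes about
`η (w / k) / (d - 1)`.  Both possible values of `M` give `n` times this probability at least
`2 w (1 + log (k / w))` (`sparse_exponent_le`), twice the exponent that bounds the number of
`w`-sets (`sum_nonempty_exp_le`).

If `p = |P|` is less than half of `k`, the first property alone is not strong enough: the number of
sets `P` is about `exp (p log (e k / p))`, while the probability is only about `exp (-n s)` up to
constants in the exponent, where `s = Ω₁ + η p / k`.  The second property supplies a factor
`n.choose p * ((p / k) s) ^ p`, and the product is at most `(e ^ 2 x exp (-x / 4)) ^ p` for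
`x = n s / p`, which is small as `x ≥ n / k` is large (`choose_mul_choose_mul_exp_le`).  The sum
over all `P` is of order `exp (-n Ω₁ / 16)` (`sum_stuck_le`), and `n Ω₁` tends to infinity if
`D = o(k)`, for the soliton distribution.  In the adjusted case `d < log (1 / δ)` implies
`1 - η ≥ 0.3 / log k`, because `H_D - log (D + 1)` is bounded below
(`bpError_adjustedSoliton_le_of_queryDifficulty`).

*Optimal estimator.*  Any vector consistent with the answers will do: it differs from the true one
on a set that every query meets in an even number of variables.  Small sets are excluded as above,
and large ones have an odd intersection with a query with probability at least `1 / 24`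
(`le_oddHitProb`).

*Degree one.*  BP recovers all variables that are asked for, and the expected number of the others
is at most `k exp (-n / k)`, so that Markov's inequality suffices (`bpError_unitDegree_le`).
-/

/-! ### The peeling decoder -/

namespace BPState

/-- The input nodes that have been covered. -/
def covered {k n : ℕ} (s : BPState k n) : Finset (Fin k) :=
  Finset.univ.filter fun i => (s.est i).isSome = true

/-- The invariants of peeling decoding on the design `G` with true values `x` that hold both
between and inside steps.  The last one counts queries: each covered variable was released by a
query of its own, all of whose variables are covered. -/
structure Sound {k n : ℕ} (G : Design k n) (x : Fin k → ZMod 2) (s : BPState k n) : Prop where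
  est_eq : ∀ i v, s.est i = some v → v = x i
  processed_subset : s.processed ⊆ s.covered
  nbr_eq : ∀ a, s.nbr a = G a \ s.processed
  par_eq : ∀ a, s.par a = ∑ i ∈ s.nbr a, x i
  card_le : s.covered.card ≤
    (Finset.univ.filter fun a => (G a).Nonempty ∧ G a ⊆ s.covered).card

/-- No output node of degree one has an uncovered neighbor. -/
def Saturated {k n : ℕ} (s : BPState k n) : Prop :=
  ∀ a i, s.nbr a = {i} → i ∈ s.covered

variable {k n : ℕ} {G : Design k n} {x : Fin k → ZMod 2} {s : BPState k n}

lemma mem_covered {i : Fin k} : i ∈ s.covered ↔ ∃ v, s.est i = some v := by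
  simp [covered, Option.isSome_iff_exists]

lemma mem_covered_cover {i : Fin k} :
    i ∈ s.cover.covered ↔ i ∈ s.covered ∨ ∃ a, s.nbr a = {i} := by
  rw [mem_covered, mem_covered]
  rcases h : s.est i with _ | v
  · by_cases h2 : ∃ a, s.nbr a = {i} <;> simp [cover, h, h2]
  · simp [cover, h]

lemma sound_init : Sound G x (init G (answers G x)) where
  est_eq := by simp [init]
  processed_subset := by simp [init]
  nbr_eq := by simp [init]
  par_eq := by simp [init, answers]
  card_le := by simp [init, covered]

lemma Sound.cover (h : Sound G x s) : Sound G x s.cover where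
  est_eq := by
    intro i v hv
    rcases h1 : s.est i with _ | u
    · by_cases h2 : ∃ a, s.nbr a = {i}
      · have : s.par h2.choose = v := by simpa [BPState.cover, h1, h2] using hv
        rw [← this, h.par_eq, h2.choose_spec, Finset.sum_singleton]
      · simp [BPState.cover, h1, h2] at hv
    · have : v = u := by simpa [BPState.cover, h1, eq_comm] using hv
      exact this ▸ h.est_eq i u h1
  processed_subset := fun i hi => mem_covered_cover.2 (Or.inl (h.processed_subset hi))
  nbr_eq := h.nbr_eq
  par_eq := h.par_eq
  card_le := by
    have hsub : s.covered ⊆ s.cover.covered := fun i hi => mem_covered_cover.2 (Or.inl hi)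
    have hex : ∀ i ∈ s.cover.covered \ s.covered, ∃ a, s.nbr a = {i} := by
      intro i hi
      rw [Finset.mem_sdiff, mem_covered_cover] at hi
      exact hi.1.resolve_left hi.2
    rcases (s.cover.covered \ s.covered).eq_empty_or_nonempty with hnew | ⟨i₀, hi₀⟩
    · have : s.cover.covered = s.covered := (Finset.sdiff_eq_empty_iff_subset.1 hnew).antisymm hsub
      rw [this]
      exact h.card_le
    have : Nonempty (Fin n) := ⟨(hex i₀ hi₀).choose⟩
    choose! f hf using hex
    have hmem : ∀ i ∈ s.cover.covered \ s.covered, i ∈ G (f i) := by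
      intro i hi
      have : i ∈ s.nbr (f i) := by rw [hf i hi]; simp
      rw [h.nbr_eq] at this
      exact (Finset.mem_sdiff.1 this).1
    set A := Finset.univ.filter fun a => (G a).Nonempty ∧ G a ⊆ s.covered with hA
    set B := Finset.univ.filter fun a => (G a).Nonempty ∧ G a ⊆ s.cover.covered with hB
    have hcard : ((s.cover.covered \ s.covered).image f).card =
        (s.cover.covered \ s.covered).card := by
      refine Finset.card_image_of_injOn fun i hi j hj hij => ?_
      have := hf i hi
      rw [hij, hf j hj] at this
      exact (Finset.singleton_injective this).symm
    have hdisj : Disjoint A ((s.cover.covered \ s.covered).image f) := by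
      rw [Finset.disjoint_left]
      intro a ha ha'
      obtain ⟨i, hi, rfl⟩ := Finset.mem_image.1 ha'
      exact (Finset.mem_sdiff.1 hi).2 ((Finset.mem_filter.1 ha).2.2 (hmem i hi))
    have hAB : A ∪ (s.cover.covered \ s.covered).image f ⊆ B := by
      intro a ha
      rcases Finset.mem_union.1 ha with ha | ha
      · have := (Finset.mem_filter.1 ha).2
        exact Finset.mem_filter.2 ⟨Finset.mem_univ _, this.1, this.2.trans hsub⟩
      · obtain ⟨i, hi, rfl⟩ := Finset.mem_image.1 ha
        refine Finset.mem_filter.2 ⟨Finset.mem_univ _, ⟨i, hmem i hi⟩, fun j hj => ?_⟩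
        by_cases hjp : j ∈ s.processed
        · exact hsub (h.processed_subset hjp)
        · have : j ∈ s.nbr (f i) := by
            rw [h.nbr_eq]; exact Finset.mem_sdiff.2 ⟨hj, hjp⟩
          rw [hf i hi, Finset.mem_singleton] at this
          exact this ▸ (Finset.mem_sdiff.1 hi).1
    have h1 := Finset.card_le_card hAB
    rw [Finset.card_union_of_disjoint hdisj, hcard] at h1
    have h2 := Finset.card_sdiff_add_card_eq_card hsub
    have h3 : s.covered.card ≤ A.card := h.card_le
    exact le_trans (by omega) h1

lemma saturated_cover : s.cover.Saturated :=
  fun a _ ha => mem_covered_cover.2 (Or.inr ⟨a, ha⟩)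

lemma Sound.process (h : Sound G x s) {i : Fin k} (hi : i ∈ s.covered) :
    Sound G x (s.process i) where
  est_eq := h.est_eq
  processed_subset := by
    intro j hj
    rcases Finset.mem_insert.1 hj with rfl | hj
    · exact hi
    · exact h.processed_subset hj
  nbr_eq := by
    intro a
    ext j
    simp [BPState.process, h.nbr_eq]
    tauto
  par_eq := by
    intro a
    obtain ⟨v, hv⟩ := mem_covered.1 hi
    have hx := h.est_eq i v hv
    by_cases hia : i ∈ s.nbr a
    · have h2 := Finset.add_sum_erase (s.nbr a) x hia
      simp only [BPState.process, hia, if_true, hv, Option.getD_some, h.par_eq, ← h2, hx]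
      have h3 : x i + x i = 0 := CharTwo.add_self_eq_zero _
      rw [add_comm (x i), add_assoc, h3, add_zero]
    · simp [BPState.process, hia, h.par_eq]
  card_le := h.card_le

lemma Sound.step (h : Sound G x s) : Sound G x s.step := by
  unfold BPState.step
  split_ifs with hr
  · have := (Finset.mem_filter.1 (Finset.min'_mem _ hr)).2.1
    exact (h.process (by simpa [covered] using this)).cover
  · exact h

lemma Saturated.step (h : s.Saturated) : s.step.Saturated := by
  unfold BPState.step
  split_ifs with hr
  · exact saturated_cover
  · exact h

/-- Every effective step processes a new input node. -/
lemma ripple_iterate_eq_empty_or_le (s : BPState k n) (t : ℕ) :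
    (BPState.step^[t] s).ripple = ∅ ∨ t ≤ (BPState.step^[t] s).processed.card := by
  induction t with
  | zero => simp
  | succ t ih =>
    rw [Function.iterate_succ_apply']
    set u := BPState.step^[t] s
    by_cases hr : u.ripple.Nonempty
    · right
      have hnot := (Finset.mem_filter.1 (Finset.min'_mem _ hr)).2.2
      have ih' := ih.resolve_left hr.ne_empty
      simp only [BPState.step, hr, dif_pos]
      simp only [BPState.cover, BPState.process]
      rw [Finset.card_insert_of_notMem hnot]
      omega
    · left
      simp only [BPState.step, hr, dif_neg, not_false_eq_true]
      exact Finset.not_nonempty_iff_eq_empty.1 hr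

end BPState

/-- The variables that the BP decoder recovers with their true value. -/
noncomputable def bpRecovered {k n : ℕ} (G : Design k n) (x : Fin k → ZMod 2) : Finset (Fin k) :=
  Finset.univ.filter fun i => bpDecode G (answers G x) i = some (x i)

section BPDecode
open BPState

variable {k n : ℕ} (G : Design k n) (x : Fin k → ZMod 2)

lemma exists_final_state : ∃ s : BPState k n, Sound G x s ∧ s.Saturated ∧ s.ripple = ∅ ∧
    s.covered = bpRecovered G x := by
  have key : ∀ t, Sound G x (BPState.step^[t] (init G (answers G x)).cover) ∧
      (BPState.step^[t] (init G (answers G x)).cover).Saturated := by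
    intro t
    induction t with
    | zero => exact ⟨sound_init.cover, saturated_cover⟩
    | succ t ih =>
      rw [Function.iterate_succ_apply']
      exact ⟨ih.1.step, ih.2.step⟩
  refine ⟨_, (key k).1, (key k).2, ?_, ?_⟩
  · rcases ripple_iterate_eq_empty_or_le (init G (answers G x)).cover k with h | h
    · exact h
    · have : (BPState.step^[k] (init G (answers G x)).cover).processed = Finset.univ := by
        apply Finset.eq_univ_of_card
        apply le_antisymm (Finset.card_le_univ _)
        simpa using h
      simp [ripple, this]
  · ext i
    rw [mem_covered]
    simp only [bpRecovered, Finset.mem_filter, Finset.mem_univ, true_and]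
    exact ⟨fun ⟨v, hv⟩ => by rw [← (key k).1.est_eq i v hv]; exact hv, fun h => ⟨_, h⟩⟩

/-- The unrecovered variables form a stopping set. -/
lemma card_inter_compl_bpRecovered_ne_one (a : Fin n) :
    (G a ∩ (bpRecovered G x)ᶜ).card ≠ 1 := by
  obtain ⟨s, hs, hsat, hr, hc⟩ := exists_final_state G x
  intro h1
  obtain ⟨i, hi⟩ := Finset.card_eq_one.1 h1
  have hp : s.processed = s.covered := by
    refine hs.processed_subset.antisymm fun j hj => ?_
    by_contra hjp
    have : j ∈ s.ripple := by
      simp only [ripple, Finset.mem_filter, Finset.mem_univ, true_and]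
      exact ⟨by simpa [covered] using hj, hjp⟩
    simp [hr] at this
  have hn : s.nbr a = {i} := by
    rw [hs.nbr_eq, hp, hc, ← hi]
    ext j; simp
  have h2 := hsat a i hn
  have h3 : i ∈ G a ∩ (bpRecovered G x)ᶜ := by rw [hi]; simp
  rw [hc] at h2
  exact (Finset.mem_compl.1 (Finset.mem_inter.1 h3).2) h2

/-- There are at least as many queries about recovered variables only as recovered variables. -/
lemma exists_queries_subset_bpRecovered : ∃ A : Finset (Fin n), A.card = (bpRecovered G x).card ∧
    ∀ a ∈ A, (G a).Nonempty ∧ G a ⊆ bpRecovered G x := by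
  obtain ⟨s, hs, -, -, hc⟩ := exists_final_state G x
  have h := hs.card_le
  rw [hc] at h
  obtain ⟨A, hA, hcard⟩ := Finset.exists_subset_card_eq h
  exact ⟨A, hcard, fun a ha => (Finset.mem_filter.1 (hA ha)).2⟩

end BPDecode

/-! ### Probabilities of events about independent queries -/

open Classical in
/-- Probability that the set of variables asked for by one query satisfies `Q`. -/
noncomputable def queryEventProb (Ω : ℕ → ℝ) {k : ℕ} (Q : Finset (Fin k) → Prop) : ℝ :=
  ∑ T : Finset (Fin k) with Q T, queryProb Ω T

section Probability

variable {Ω : ℕ → ℝ} {k n : ℕ}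

lemma queryProb_nonneg (hΩ : ∀ d, 0 ≤ Ω d) (T : Finset (Fin k)) : 0 ≤ queryProb Ω T :=
  div_nonneg (hΩ _) (Nat.cast_nonneg _)

lemma queryEventProb_nonneg (hΩ : ∀ d, 0 ≤ Ω d) (Q : Finset (Fin k) → Prop) :
    0 ≤ queryEventProb Ω Q :=
  Finset.sum_nonneg fun T _ => queryProb_nonneg hΩ T

lemma queryEventProb_mono (hΩ : ∀ d, 0 ≤ Ω d) {Q R : Finset (Fin k) → Prop}
    (h : ∀ T, Q T → R T) : queryEventProb Ω Q ≤ queryEventProb Ω R := by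
  classical
  exact Finset.sum_le_sum_of_subset_of_nonneg
      (Finset.monotone_filter_right _ fun T _ hT => h T hT) fun T _ _ => queryProb_nonneg hΩ T

lemma queryEventProb_eq_sum (Q : Finset (Fin k) → Prop) [DecidablePred Q] :
    queryEventProb Ω Q = ∑ d ∈ Finset.range (k + 1),
      ((((Finset.univ : Finset (Fin k)).powersetCard d).filter Q).card / (k.choose d : ℝ)) *
        Ω d := by
  have h : queryEventProb Ω Q =
      ∑ T ∈ (Finset.univ : Finset (Fin k)).powerset, if Q T then queryProb Ω T else 0 := by
    rw [Finset.powerset_univ, queryEventProb, ← Finset.sum_filter]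
    congr!
  rw [h, Finset.sum_powerset, Finset.card_univ, Fintype.card_fin]
  refine Finset.sum_congr rfl fun d _ => ?_
  rw [← Finset.sum_filter, Finset.sum_congr rfl (g := fun _ => Ω d / (k.choose d : ℝ))]
  · rw [Finset.sum_const, nsmul_eq_mul]; ring
  · intro T hT
    rw [queryProb, (Finset.mem_powersetCard.1 (Finset.mem_filter.1 hT).1).2]

lemma queryEventProb_true : queryEventProb Ω (fun _ : Finset (Fin k) => True) =
    ∑ d ∈ Finset.range (k + 1), Ω d := by
  rw [queryEventProb_eq_sum]
  refine Finset.sum_congr rfl fun d hd => ?_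
  have : (k.choose d : ℝ) ≠ 0 := by
    have := Nat.choose_pos (Nat.lt_succ_iff.1 (Finset.mem_range.1 hd))
    positivity
  simp [this]

lemma queryEventProb_not (hsum : ∑ d ∈ Finset.range (k + 1), Ω d = 1)
    (Q : Finset (Fin k) → Prop) :
    queryEventProb Ω (fun T => ¬ Q T) = 1 - queryEventProb Ω Q := by
  classical
  rw [← hsum, ← queryEventProb_true, eq_sub_iff_add_eq']
  simp only [queryEventProb, Finset.filter_true]
  convert Finset.sum_filter_add_sum_filter_not Finset.univ Q (fun T => queryProb Ω T)

lemma designProb_nonneg (hΩ : ∀ d, 0 ≤ Ω d) (E : Design k n → Prop) : 0 ≤ designProb Ω E :=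
  Finset.sum_nonneg fun _ _ => Finset.prod_nonneg fun _ _ => queryProb_nonneg hΩ _

/-- The union bound. -/
lemma designProb_le_sum (hΩ : ∀ d, 0 ≤ Ω d) {ι : Type*} (S : Finset ι) {E : Design k n → Prop}
    {F : ι → Design k n → Prop} (h : ∀ G, E G → ∃ i ∈ S, F i G) :
    designProb Ω E ≤ ∑ i ∈ S, designProb Ω (F i) := by
  classical
  have hw : ∀ G : Design k n, 0 ≤ ∏ a, queryProb Ω (G a) :=
    fun G => Finset.prod_nonneg fun _ _ => queryProb_nonneg hΩ _
  simp only [designProb, Finset.sum_filter]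
  rw [Finset.sum_comm]
  refine Finset.sum_le_sum fun G _ => ?_
  have hnn : ∀ i ∈ S, 0 ≤ (if F i G then ∏ a, queryProb Ω (G a) else 0) := by
    intro i _; split_ifs; exacts [hw G, le_rfl]
  by_cases hE : E G
  · obtain ⟨i, hi, hF⟩ := h G hE
    refine le_trans (le_of_eq ?_) (Finset.single_le_sum hnn hi)
    simp [hE, hF]
  · simpa [hE] using Finset.sum_nonneg hnn

/-- The union bound, with a counting variable: Markov's inequality. -/
lemma mul_designProb_le_sum (hΩ : ∀ d, 0 ≤ Ω d) {ι : Type*} (S : Finset ι)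
    {E : Design k n → Prop} {F : ι → Design k n → Prop} (t : ℝ)
    (h : ∀ G, E G → ∃ S' ⊆ S, t ≤ S'.card ∧ ∀ i ∈ S', F i G) :
    t * designProb Ω E ≤ ∑ i ∈ S, designProb Ω (F i) := by
  classical
  have hw : ∀ G : Design k n, 0 ≤ ∏ a, queryProb Ω (G a) :=
    fun G => Finset.prod_nonneg fun _ _ => queryProb_nonneg hΩ _
  simp only [designProb, Finset.sum_filter, Finset.mul_sum]
  rw [Finset.sum_comm]
  refine Finset.sum_le_sum fun G _ => ?_
  have hnn : ∀ i ∈ S, 0 ≤ (if F i G then ∏ a, queryProb Ω (G a) else 0) := by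
    intro i _; split_ifs; exacts [hw G, le_rfl]
  by_cases hE : E G
  · obtain ⟨S', hS', ht, hF⟩ := h G hE
    refine le_trans ?_ (Finset.sum_le_sum_of_subset_of_nonneg hS' fun i hi _ => hnn i hi)
    rw [if_pos hE, Finset.sum_congr rfl (g := fun _ => ∏ a, queryProb Ω (G a))]
    · rw [Finset.sum_const, nsmul_eq_mul]
      exact mul_le_mul_of_nonneg_right ht (hw G)
    · intro i hi; simp [hF i hi]
  · simpa [hE] using Finset.sum_nonneg hnn

/-- Independence of the queries. -/
lemma designProb_forall (Q : Fin n → Finset (Fin k) → Prop) :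
    designProb Ω (fun G : Design k n => ∀ a, Q a (G a)) = ∏ a, queryEventProb Ω (Q a) := by
  classical
  simp only [designProb, queryEventProb]
  rw [Finset.prod_univ_sum]
  refine Finset.sum_congr ?_ fun _ _ => rfl
  ext G
  simp [Fintype.mem_piFinset]

end Probability

/-! ### Failure events of the decoders -/

/-- Probability that a query meets `W` in exactly one variable. -/
noncomputable def singleHitProb (Ω : ℕ → ℝ) {k : ℕ} (W : Finset (Fin k)) : ℝ :=
  queryEventProb Ω fun T => (T ∩ W).card = 1

/-- Probability that a query meets `W` in an odd number of variables. -/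
noncomputable def oddHitProb (Ω : ℕ → ℝ) {k : ℕ} (W : Finset (Fin k)) : ℝ :=
  queryEventProb Ω fun T => Odd (T ∩ W).card

/-- Probability that a query is nonempty and asks for variables of `P` only. -/
noncomputable def insideProb (Ω : ℕ → ℝ) {k : ℕ} (P : Finset (Fin k)) : ℝ :=
  queryEventProb Ω fun T => T.Nonempty ∧ T ⊆ P

section FailureEvents

variable {Ω : ℕ → ℝ} {k n : ℕ}

lemma singleHitProb_le_oddHitProb (hΩ : ∀ d, 0 ≤ Ω d) (W : Finset (Fin k)) :
    singleHitProb Ω W ≤ oddHitProb Ω W :=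
  queryEventProb_mono hΩ fun T hT => by rw [hT]; exact odd_one

lemma queryEventProb_le_one (hΩ : ∀ d, 0 ≤ Ω d) (hsum : ∑ d ∈ Finset.range (k + 1), Ω d = 1)
    (Q : Finset (Fin k) → Prop) : queryEventProb Ω Q ≤ 1 := by
  rw [← hsum, ← queryEventProb_true]
  exact queryEventProb_mono hΩ fun _ _ => trivial

lemma designProb_forall_not_le_exp (hΩ : ∀ d, 0 ≤ Ω d)
    (hsum : ∑ d ∈ Finset.range (k + 1), Ω d = 1) (Q : Finset (Fin k) → Prop) :
    designProb Ω (fun G : Design k n => ∀ a, ¬ Q (G a)) ≤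
      Real.exp (-(n * queryEventProb Ω Q)) := by
  rw [designProb_forall (fun _ T => ¬ Q T), Finset.prod_const, Finset.card_univ,
    Fintype.card_fin, queryEventProb_not hsum, ← mul_neg, Real.exp_nat_mul]
  exact pow_le_pow_left₀ (sub_nonneg.2 (queryEventProb_le_one hΩ hsum Q))
    (Real.one_sub_le_exp_neg _) n

/-- A query either belongs to the `|P|` queries that released the variables of `P`, or does not
meet the complement of `P` in exactly one variable. -/
lemma designProb_stuck_le (hΩ : ∀ d, 0 ≤ Ω d)
    (hsum : ∑ d ∈ Finset.range (k + 1), Ω d = 1) (P : Finset (Fin k)) :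
    designProb Ω (fun G : Design k n => (∃ A : Finset (Fin n), A.card = P.card ∧
        ∀ a ∈ A, (G a).Nonempty ∧ G a ⊆ P) ∧ ∀ a, (G a ∩ Pᶜ).card ≠ 1) ≤
      n.choose P.card * insideProb Ω P ^ P.card *
        Real.exp (-((n - P.card : ℕ) * singleHitProb Ω Pᶜ)) := by
  classical
  have h1 : designProb Ω (fun G : Design k n => (∃ A : Finset (Fin n), A.card = P.card ∧
        ∀ a ∈ A, (G a).Nonempty ∧ G a ⊆ P) ∧ ∀ a, (G a ∩ Pᶜ).card ≠ 1) ≤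
      ∑ A ∈ (Finset.univ : Finset (Fin n)).powersetCard P.card,
        designProb Ω (fun G : Design k n => ∀ a,
          if a ∈ A then (G a).Nonempty ∧ G a ⊆ P else ¬ (G a ∩ Pᶜ).card = 1) := by
    apply designProb_le_sum hΩ
    rintro G ⟨⟨A, hA, hA'⟩, hG⟩
    refine ⟨A, Finset.mem_powersetCard.2 ⟨Finset.subset_univ _, hA⟩, fun a => ?_⟩
    by_cases ha : a ∈ A
    · simpa [ha] using hA' a ha
    · simpa [ha] using hG a
  refine h1.trans (le_of_le_of_eq (Finset.sum_le_card_nsmul _ _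
    (insideProb Ω P ^ P.card * Real.exp (-((n - P.card : ℕ) * singleHitProb Ω Pᶜ))) ?_) ?_)
  · intro A hA
    have hcard := (Finset.mem_powersetCard.1 hA).2
    rw [designProb_forall (fun a T =>
      if a ∈ A then T.Nonempty ∧ T ⊆ P else ¬ (T ∩ Pᶜ).card = 1)]
    have h2 : ∀ a, queryEventProb Ω (fun T : Finset (Fin k) =>
        if a ∈ A then T.Nonempty ∧ T ⊆ P else ¬ (T ∩ Pᶜ).card = 1) =
        if a ∈ A then insideProb Ω P else 1 - singleHitProb Ω Pᶜ := by
      intro a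
      by_cases ha : a ∈ A
      · simp only [ha, if_true]; rfl
      · simp only [ha, if_false, singleHitProb]; exact queryEventProb_not hsum _
    simp only [h2]
    rw [Finset.prod_ite, Finset.prod_const, Finset.prod_const]
    have h3 : (Finset.univ.filter fun a => a ∈ A).card = P.card := by
      rw [Finset.filter_univ_mem, hcard]
    have h4 : (Finset.univ.filter fun a => a ∉ A).card = n - P.card := by
      have := Finset.card_filter_add_card_filter_not (s := (Finset.univ : Finset (Fin n)))
        (fun a => a ∈ A)
      rw [h3, Finset.card_univ, Fintype.card_fin] at this
      omega
    rw [h3, h4, ← mul_neg, Real.exp_nat_mul]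
    refine mul_le_mul_of_nonneg_left ?_ (pow_nonneg (queryEventProb_nonneg hΩ _) _)
    exact pow_le_pow_left₀ (sub_nonneg.2 (queryEventProb_le_one hΩ hsum _))
      (Real.one_sub_le_exp_neg _) _
  · rw [Finset.card_powersetCard, Finset.card_univ, Fintype.card_fin, nsmul_eq_mul, mul_assoc]

/-- BP fails only if it is stuck at a large unrecovered set; small unrecovered sets `W` are
treated as stopping sets, and large ones through the set `P` of recovered variables. -/
lemma bpError_le (hΩ : ∀ d, 0 ≤ Ω d) (hsum : ∑ d ∈ Finset.range (k + 1), Ω d = 1) (δ : ℝ) :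
    bpError Ω k n (1 - δ) ≤
      (∑ W : Finset (Fin k) with δ * k < W.card ∧ 2 * W.card ≤ k,
        Real.exp (-(n * singleHitProb Ω W))) +
      ∑ P : Finset (Fin k) with 2 * P.card < k,
        n.choose P.card * insideProb Ω P ^ P.card *
          Real.exp (-((n - P.card : ℕ) * singleHitProb Ω Pᶜ)) := by
  classical
  refine ciSup_le fun x => ?_
  let F : Finset (Fin k) ⊕ Finset (Fin k) → Design k n → Prop := Sum.elim
    (fun W G => ∀ a, ¬ (G a ∩ W).card = 1)
    (fun P G => (∃ A : Finset (Fin n), A.card = P.card ∧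
        ∀ a ∈ A, (G a).Nonempty ∧ G a ⊆ P) ∧ ∀ a, (G a ∩ Pᶜ).card ≠ 1)
  refine (designProb_le_sum hΩ (Finset.disjSum
    (Finset.univ.filter fun W : Finset (Fin k) => δ * k < W.card ∧ 2 * W.card ≤ k)
    (Finset.univ.filter fun P : Finset (Fin k) => 2 * P.card < k)) (F := F) ?_).trans ?_
  · intro G hG
    have hG' : ((bpRecovered G x).card : ℝ) < (1 - δ) * k := hG
    have hcard := Finset.card_add_card_compl (bpRecovered G x)
    rw [Fintype.card_fin] at hcard
    by_cases h : 2 * (bpRecovered G x).card < k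
    · refine ⟨Sum.inr (bpRecovered G x), by simpa using h, ?_⟩
      exact ⟨exists_queries_subset_bpRecovered G x, card_inter_compl_bpRecovered_ne_one G x⟩
    · refine ⟨Sum.inl (bpRecovered G x)ᶜ, ?_, card_inter_compl_bpRecovered_ne_one G x⟩
      have : ((bpRecovered G x).card : ℝ) + ((bpRecovered G x)ᶜ.card : ℝ) = k := by
        exact_mod_cast hcard
      simp only [Finset.inl_mem_disjSum, Finset.mem_filter, Finset.mem_univ, true_and]
      exact ⟨by linarith, by omega⟩
  · rw [Finset.sum_disjSum]
    exact add_le_add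
      (Finset.sum_le_sum fun W _ =>
        designProb_forall_not_le_exp hΩ hsum fun T => (T ∩ W).card = 1)
      (Finset.sum_le_sum fun P _ => designProb_stuck_le hΩ hsum P)

/-- The estimator that returns any vector consistent with the answers fails only if some vector of
large weight is orthogonal to all queries. -/
lemma optimalError_le (hΩ : ∀ d, 0 ≤ Ω d) (hsum : ∑ d ∈ Finset.range (k + 1), Ω d = 1)
    (hk : 0 < k) (δ : ℝ) :
    optimalError Ω k n (1 - δ) ≤
      ∑ W : Finset (Fin k) with δ * k < W.card, Real.exp (-(n * oddHitProb Ω W)) := by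
  classical
  let xhat : Design k n → (Fin n → ZMod 2) → Fin k → ZMod 2 := fun G y =>
    if h : ∃ z, answers G z = y then h.choose else 0
  refine (ciInf_le (Set.finite_range _).bddBelow xhat).trans (ciSup_le fun x => ?_)
  refine (designProb_le_sum hΩ _ (F := fun W G => ∀ a, ¬ Odd (G a ∩ W).card) ?_).trans
    (Finset.sum_le_sum fun W _ =>
      designProb_forall_not_le_exp hΩ hsum fun T => Odd (T ∩ W).card)
  intro G hG
  have hex : ∃ z, answers G z = answers G x := ⟨x, rfl⟩
  have hx : xhat G (answers G x) = hex.choose := by simp [xhat, hex]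
  rw [hx] at hG
  set z := hex.choose
  have hz : answers G z = answers G x := hex.choose_spec
  refine ⟨Finset.univ.filter fun i => ¬ x i = z i, ?_, fun a => ?_⟩
  · simp only [Finset.mem_filter, Finset.mem_univ, true_and]
    have h1 := Finset.card_filter_add_card_filter_not (s := (Finset.univ : Finset (Fin k)))
        (fun i => x i = z i)
    rw [Finset.card_univ, Fintype.card_fin] at h1
    have h2 : ((Finset.univ.filter fun i => x i = z i).card : ℝ) +
        ((Finset.univ.filter fun i => ¬ x i = z i).card : ℝ) = k := by exact_mod_cast h1
    have hk' : (0 : ℝ) < k := by exact_mod_cast hk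
    rw [agreement, div_lt_iff₀ hk'] at hG
    linarith
  · have h1 : ∑ i ∈ G a, (x i + z i) = 0 := by
      have := congrFun hz a
      simp only [answers] at this
      rw [Finset.sum_add_distrib, this, CharTwo.add_self_eq_zero]
    have h2 : ∀ i, x i + z i = if ¬ x i = z i then 1 else 0 := by
      intro i
      generalize x i = u
      generalize z i = v
      revert u v
      decide
    simp only [h2] at h1
    rw [← Finset.sum_filter, Finset.sum_const, nsmul_eq_mul, mul_one,
      ZMod.natCast_eq_zero_iff_even] at h1
    rw [← Finset.filter_mem_eq_inter]
    simpa using h1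

end FailureEvents

/-! ### Binomial coefficients -/

lemma choose_succ_le_choose_sub_add (N m a : ℕ) (ha : a ≤ N + 1) :
    (N + 1).choose (m + 1) ≤ (N + 1 - a).choose (m + 1) + a * N.choose m := by
  induction a with
  | zero => simp
  | succ a ih =>
    have h1 := ih (by omega)
    have h2 : N + 1 - a = (N - a) + 1 := by omega
    have h3 : N + 1 - (a + 1) = N - a := by omega
    have h4 : (N - a).choose m ≤ N.choose m := Nat.choose_le_choose m (by omega)
    rw [h2, Nat.choose_succ_succ' (N - a) m] at h1
    rw [h3, add_mul, one_mul]
    omega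

/-- The probability that `m` of `N` elements avoid a set of `a` elements is at least
`1 - a m / N`. -/
lemma one_sub_mul_choose_le (N m a : ℕ) (ha : a ≤ N) :
    (1 - (a : ℝ) * m / N) * N.choose m ≤ ((N - a).choose m : ℝ) := by
  rcases m with _ | m
  · simp
  rcases N with _ | N
  · simp
  have h1 : ((N + 1).choose (m + 1) : ℝ) ≤ (N + 1 - a).choose (m + 1) + a * N.choose m := by
    exact_mod_cast choose_succ_le_choose_sub_add N m a ha
  have h2 : ((N : ℝ) + 1) * N.choose m = (N + 1).choose (m + 1) * ((m : ℝ) + 1) := by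
    exact_mod_cast Nat.add_one_mul_choose_eq N m
  have h3 : (N.choose m : ℝ) = (N + 1).choose (m + 1) * ((m : ℝ) + 1) / ((N : ℝ) + 1) := by
    rw [eq_div_iff (by positivity), mul_comm, h2]
  rw [h3] at h1
  push_cast
  have h4 : (1 - (a : ℝ) * (m + 1) / (N + 1)) * (N + 1).choose (m + 1) =
      (N + 1).choose (m + 1) - a * ((N + 1).choose (m + 1) * ((m : ℝ) + 1) / ((N : ℝ) + 1)) := by
    ring
  rw [h4]
  linarith

lemma choose_mul_pow_le {p k : ℕ} (hpk : p ≤ k) (d : ℕ) :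
    p.choose d * k ^ d ≤ k.choose d * p ^ d := by
  induction d with
  | zero => simp
  | succ d ih =>
    have h1 : (p - d) * k ≤ (k - d) * p := by
      rcases le_total p d with h | h
      · simp [Nat.sub_eq_zero_of_le h]
      · zify [h, h.trans hpk]
        have : (p : ℤ) ≤ k := by exact_mod_cast hpk
        nlinarith
    refine Nat.le_of_mul_le_mul_right ?_ (Nat.succ_pos d)
    calc p.choose (d + 1) * k ^ (d + 1) * (d + 1)
        = (p.choose (d + 1) * (d + 1)) * k ^ (d + 1) := by ring
      _ = (p.choose d * k ^ d) * ((p - d) * k) := by rw [Nat.choose_succ_right_eq]; ring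
      _ ≤ (k.choose d * p ^ d) * ((k - d) * p) := Nat.mul_le_mul ih h1
      _ = (k.choose (d + 1) * (d + 1)) * p ^ (d + 1) := by rw [Nat.choose_succ_right_eq]; ring
      _ = k.choose (d + 1) * p ^ (d + 1) * (d + 1) := by ring

lemma choose_div_choose_le_pow {p k d : ℕ} (hpk : p ≤ k) (hdk : d ≤ k) :
    (p.choose d : ℝ) / k.choose d ≤ ((p : ℝ) / k) ^ d := by
  have h1 : (0 : ℝ) < k.choose d := by exact_mod_cast Nat.choose_pos hdk
  rcases Nat.eq_zero_or_pos k with rfl | hk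
  · have : d = 0 := by omega
    simp [this]
  have h2 : (0 : ℝ) < (k : ℝ) ^ d := by positivity
  rw [div_pow, div_le_div_iff₀ h1 h2]
  have := choose_mul_pow_le hpk d
  rw [mul_comm ((p : ℝ) ^ d)]
  exact_mod_cast this

/-! ### Hitting probabilities under the adjusted soliton distribution -/

lemma soliton_eq_adjustedSoliton (D : ℕ) : soliton D = adjustedSoliton D 1 := by
  funext d; simp [soliton, adjustedSoliton]

lemma adjustedSoliton_nonneg {D : ℕ} {η : ℝ} (h0 : 0 ≤ η) (h1 : η ≤ 1) (d : ℕ) :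
    0 ≤ adjustedSoliton D η d := by
  unfold adjustedSoliton
  split_ifs with h h'
  · have : 0 ≤ η / (D : ℝ) := by positivity
    linarith
  · have : (2 : ℝ) ≤ d := by exact_mod_cast h'.1
    exact div_nonneg h0 (mul_nonneg (by linarith) (by linarith))
  · exact le_rfl

section AdjustedSoliton

variable {k m n : ℕ} {η : ℝ}

/-- Sums against the adjusted soliton distribution with maximum degree `m + 1`. -/
lemma sum_mul_adjustedSoliton (hmk : m + 1 ≤ k) (η : ℝ) (g : ℕ → ℝ) :
    ∑ d ∈ Finset.range (k + 1), g d * adjustedSoliton (m + 1) η d =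
      g 1 * (1 - η + η / (m + 1)) +
        ∑ j ∈ Finset.range m, g (j + 2) * (η / ((j + 2) * (j + 1))) := by
  have h1 : ∑ d ∈ Finset.range (k + 1), g d * adjustedSoliton (m + 1) η d =
      ∑ d ∈ Finset.range (m + 2), g d * adjustedSoliton (m + 1) η d := by
    symm
    refine Finset.sum_subset (Finset.range_mono (by omega)) fun d _ hd => ?_
    rw [Finset.mem_range] at hd
    rw [adjustedSoliton, if_neg (by omega), if_neg (by omega), mul_zero]
  rw [h1, Finset.sum_range_succ', Finset.sum_range_succ', add_assoc, add_comm]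
  congr 1
  · simp [adjustedSoliton]
  · refine Finset.sum_congr rfl fun j hj => ?_
    rw [Finset.mem_range] at hj
    rw [adjustedSoliton, if_neg (by omega), if_pos (by omega)]
    push_cast
    congr 2
    ring

lemma sum_range_inv_mul (m : ℕ) :
    ∑ j ∈ Finset.range m, (1 : ℝ) / ((j + 2) * (j + 1)) = 1 - 1 / (m + 1) := by
  induction m with
  | zero => simp
  | succ m ih => rw [Finset.sum_range_succ, ih]; push_cast; field_simp; ring

lemma sum_adjustedSoliton (hmk : m + 1 ≤ k) (η : ℝ) :
    ∑ d ∈ Finset.range (k + 1), adjustedSoliton (m + 1) η d = 1 := by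
  have h := sum_mul_adjustedSoliton hmk η (fun _ => 1)
  simp only [one_mul] at h
  rw [h, Finset.sum_congr rfl (g := fun j : ℕ => η * (1 / (((j : ℝ) + 2) * (j + 1))))
    (fun j _ => by ring), ← Finset.mul_sum, sum_range_inv_mul]
  ring

lemma harmonic_cast (m : ℕ) :
    ((harmonic m : ℚ) : ℝ) = ∑ j ∈ Finset.range m, 1 / ((j : ℝ) + 1) := by
  simp [harmonic]

lemma queryDifficulty_adjustedSoliton (hmk : m + 1 ≤ k) (η : ℝ) :
    queryDifficulty (adjustedSoliton (m + 1) η) k = 1 + η * ((harmonic (m + 1) : ℚ) - 1) := by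
  have h0 : queryDifficulty (adjustedSoliton (m + 1) η) k =
      ∑ d ∈ Finset.range (k + 1), (d : ℝ) * adjustedSoliton (m + 1) η d := by
    unfold queryDifficulty
    refine Finset.sum_subset (fun d hd => ?_) fun d hd hd' => ?_
    · simp only [Finset.mem_Icc, Finset.mem_range] at *; omega
    · simp only [Finset.mem_Icc, Finset.mem_range] at *
      have : d = 0 := by omega
      simp [this]
  rw [h0, sum_mul_adjustedSoliton hmk, harmonic_succ]
  push_cast
  rw [harmonic_cast, Finset.sum_congr rfl (g := fun j : ℕ => η * (1 / ((j : ℝ) + 1)))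
    (fun j _ => by field_simp), ← Finset.mul_sum]
  field_simp
  ring

lemma queryEventProb_adjustedSoliton (hmk : m + 1 ≤ k) (η : ℝ) (Q : Finset (Fin k) → Prop)
    [DecidablePred Q] :
    queryEventProb (adjustedSoliton (m + 1) η) Q =
      ((((Finset.univ : Finset (Fin k)).powersetCard 1).filter Q).card / (k.choose 1 : ℝ)) *
        (1 - η + η / (m + 1)) +
      ∑ j ∈ Finset.range m,
        ((((Finset.univ : Finset (Fin k)).powersetCard (j + 2)).filter Q).card /
          (k.choose (j + 2) : ℝ)) * (η / ((j + 2) * (j + 1))) := by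
  rw [queryEventProb_eq_sum]
  exact sum_mul_adjustedSoliton hmk η
    (fun d => ((((Finset.univ : Finset (Fin k)).powersetCard d).filter Q).card /
      (k.choose d : ℝ)))

lemma mul_choose_le_card_single_hit (W : Finset (Fin k)) (d : ℕ) :
    W.card * (k - W.card).choose d ≤
      (((Finset.univ : Finset (Fin k)).powersetCard (d + 1)).filter
        fun T => (T ∩ W).card = 1).card := by
  have h : (W ×ˢ Wᶜ.powersetCard d).card = W.card * (k - W.card).choose d := by
    rw [Finset.card_product, Finset.card_powersetCard, Finset.card_compl, Fintype.card_fin]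
  have hinter : ∀ i ∈ W, ∀ S ⊆ Wᶜ, insert i S ∩ W = {i} := by
    intro i hi S hS
    ext j
    simp only [Finset.mem_inter, Finset.mem_insert, Finset.mem_singleton]
    refine ⟨fun ⟨h1, h2⟩ => h1.resolve_right fun h3 => Finset.mem_compl.1 (hS h3) h2, ?_⟩
    rintro rfl
    exact ⟨Or.inl rfl, hi⟩
  have hnot : ∀ i ∈ W, ∀ S ⊆ Wᶜ, i ∉ S :=
    fun i hi S hS h3 => Finset.mem_compl.1 (hS h3) hi
  rw [← h]
  refine Finset.card_le_card_of_injOn (fun q => insert q.1 q.2) ?_ ?_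
  · rintro ⟨i, S⟩ hq
    obtain ⟨hi, hS⟩ := Finset.mem_product.1 hq
    obtain ⟨hS, hc⟩ := Finset.mem_powersetCard.1 hS
    simp only [Finset.coe_filter, Set.mem_ofPred_eq, Finset.mem_powersetCard]
    refine ⟨⟨Finset.subset_univ _, ?_⟩, by rw [hinter i hi S hS, Finset.card_singleton]⟩
    rw [Finset.card_insert_of_notMem (hnot i hi S hS), hc]
  · rintro ⟨i, S⟩ hq ⟨i', S'⟩ hq' heq
    obtain ⟨hi, hS⟩ := Finset.mem_product.1 hq
    obtain ⟨hi', hS'⟩ := Finset.mem_product.1 hq'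
    replace hS := (Finset.mem_powersetCard.1 hS).1
    replace hS' := (Finset.mem_powersetCard.1 hS').1
    simp only at heq hi hi' hS hS'
    have h1 : i = i' := by
      have := congrArg (· ∩ W) heq
      simp only [hinter i hi S hS, hinter i' hi' S' hS'] at this
      exact Finset.singleton_injective this
    subst h1
    have h2 := congrArg (fun T => T.erase i) heq
    simp only [Finset.erase_insert (hnot i hi S hS), Finset.erase_insert (hnot i hi S' hS')] at h2
    rw [h2]

/-- Bonferroni's inequality for the probability that `j + 2` uniform elements hit `W` once. -/
lemma le_single_hit_ratio {w j : ℕ} (hw : 1 ≤ w) (hwk : w ≤ k) (hj : j + 2 ≤ k) :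
    ((j : ℝ) + 2) * (w / k) * (1 - (j + 1) * (w / k)) ≤
      ((w * (k - w).choose (j + 1) : ℕ) : ℝ) / k.choose (j + 2) := by
  obtain ⟨K, rfl⟩ : ∃ K, k = K + 1 := ⟨k - 1, by omega⟩
  obtain ⟨v, rfl⟩ : ∃ v, w = v + 1 := ⟨w - 1, by omega⟩
  have hpos : (0 : ℝ) < (K + 1).choose (j + 2) := by exact_mod_cast Nat.choose_pos hj
  have h1 := one_sub_mul_choose_le K (j + 1) v (by omega)
  have h2 : ((K : ℝ) + 1) * K.choose (j + 1) = (K + 1).choose (j + 2) * ((j : ℝ) + 2) := by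
    have := Nat.add_one_mul_choose_eq K (j + 1)
    have h3 : (((K + 1) * K.choose (j + 1) : ℕ) : ℝ) =
      (((K + 1).choose (j + 2) * (j + 2) : ℕ) : ℝ) := by rw [this]
    push_cast at h3
    exact h3
  have hK : (0 : ℝ) < K := by exact_mod_cast (by omega : 0 < K)
  have h4 : (v : ℝ) / K ≤ ((v : ℝ) + 1) / (K + 1) := by
    rw [div_le_div_iff₀ hK (by positivity)]
    have : (v : ℝ) ≤ K := by exact_mod_cast (by omega : v ≤ K)
    nlinarith
  have h5 : 1 - ((j : ℝ) + 1) * (((v : ℝ) + 1) / (K + 1)) ≤ 1 - (v : ℝ) * (j + 1) / K := by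
    have : (v : ℝ) * (j + 1) / K = (j + 1) * (v / K) := by ring
    rw [this]
    have := mul_le_mul_of_nonneg_left h4 (by positivity : (0 : ℝ) ≤ (j : ℝ) + 1)
    linarith
  have h6 : K + 1 - (v + 1) = K - v := by omega
  rw [h6, le_div_iff₀ hpos]
  push_cast at h1 ⊢
  have h7 : (0 : ℝ) ≤ K.choose (j + 1) := Nat.cast_nonneg _
  have h8 := (mul_le_mul_of_nonneg_right h5 h7).trans h1
  calc ((j : ℝ) + 2) * ((v + 1) / (K + 1)) * (1 - (j + 1) * ((v + 1) / (K + 1))) *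
        (K + 1).choose (j + 2)
      = ((v + 1) / (K + 1)) * (1 - (j + 1) * ((v + 1) / (K + 1))) *
        ((K + 1).choose (j + 2) * (j + 2)) := by ring
    _ = (v + 1) * ((1 - (j + 1) * ((v + 1) / (K + 1))) * K.choose (j + 1)) := by
        rw [← h2]; field_simp
    _ ≤ (v + 1) * (K - v).choose (j + 1) := mul_le_mul_of_nonneg_left h8 (by positivity)

lemma soliton_one_nonneg (h0 : 0 ≤ η) (h1 : η ≤ 1) (m : ℕ) :
    0 ≤ 1 - η + η / ((m : ℝ) + 1) := by
  have : 0 ≤ η / ((m : ℝ) + 1) := by positivity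
  linarith

/-- For small sets, all degrees up to about `k / |W|` contribute equally often. -/
lemma harmonic_le_singleHitProb (h0 : 0 ≤ η) (h1 : η ≤ 1) (hmk : m + 1 ≤ k)
    {W : Finset (Fin k)} (hW : 1 ≤ W.card) {M : ℕ} (hM : M ≤ m) (hMk : 2 * W.card * M ≤ k) :
    (W.card / k : ℝ) * η / 2 * (harmonic M : ℚ) ≤
      singleHitProb (adjustedSoliton (m + 1) η) W := by
  classical
  have hk : (0 : ℝ) < k := by exact_mod_cast (by omega : 0 < k)
  have hWk : W.card ≤ k := by simpa using W.card_le_univ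
  rw [singleHitProb, queryEventProb_adjustedSoliton hmk, harmonic_cast, Finset.mul_sum]
  refine le_add_of_nonneg_of_le ?_ ?_
  · exact mul_nonneg (by positivity) (soliton_one_nonneg h0 h1 m)
  refine le_trans ?_ (Finset.sum_le_sum_of_subset_of_nonneg (Finset.range_mono hM)
    fun j _ _ => by positivity)
  refine Finset.sum_le_sum fun j hj => ?_
  rw [Finset.mem_range] at hj
  have h2 := le_single_hit_ratio (j := j) hW hWk (by omega)
  have h3 : ((W.card * (k - W.card).choose (j + 1) : ℕ) : ℝ) / k.choose (j + 2) ≤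
      (((Finset.univ : Finset (Fin k)).powersetCard (j + 2)).filter
        fun T => (T ∩ W).card = 1).card / k.choose (j + 2) := by
    gcongr
    exact mul_choose_le_card_single_hit W (j + 1)
  have h4 : ((j : ℝ) + 1) * (W.card / k) ≤ 1 / 2 := by
    have h5 : 2 * W.card * (j + 1) ≤ k := le_trans (Nat.mul_le_mul_left _ (by omega)) hMk
    have h6 : 2 * (W.card : ℝ) * (j + 1) ≤ k := by exact_mod_cast h5
    rw [← mul_div_assoc, div_le_iff₀ hk]
    linarith
  have h5 : ((j : ℝ) + 2) * (W.card / k) * (1 / 2) ≤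
      ((j : ℝ) + 2) * (W.card / k) * (1 - (j + 1) * (W.card / k)) := by
    gcongr; linarith
  calc (W.card / k : ℝ) * η / 2 * (1 / (j + 1))
      = ((j : ℝ) + 2) * (W.card / k) * (1 / 2) * (η / ((j + 2) * (j + 1))) := by
        field_simp
    _ ≤ _ := mul_le_mul_of_nonneg_right ((h5.trans h2).trans h3) (by positivity)

/-- For all sets, the degrees one and two contribute as follows. -/
lemma degree_le_two_le_singleHitProb (h0 : 0 ≤ η) (h1 : η ≤ 1) (hm : 1 ≤ m) (hmk : m + 1 ≤ k)
    (W : Finset (Fin k)) :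
    (W.card / k : ℝ) * (1 - η + η / (m + 1) + η * ((k - W.card : ℕ) / k)) ≤
      singleHitProb (adjustedSoliton (m + 1) η) W := by
  classical
  have hk : (2 : ℝ) ≤ k := by exact_mod_cast (by omega : 2 ≤ k)
  rw [singleHitProb, queryEventProb_adjustedSoliton hmk, mul_add]
  refine add_le_add ?_ ?_
  · refine mul_le_mul_of_nonneg_right ?_ (soliton_one_nonneg h0 h1 m)
    have := mul_choose_le_card_single_hit W 0
    rw [Nat.choose_zero_right, mul_one] at this
    rw [Nat.choose_one_right]
    gcongr
  · refine le_trans ?_ (Finset.single_le_sum (fun j _ => by positivity)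
      (Finset.mem_range.2 hm : 0 ∈ Finset.range m))
    have := mul_choose_le_card_single_hit W 1
    rw [Nat.choose_one_right] at this
    have h3 : ((W.card * (k - W.card) : ℕ) : ℝ) / k.choose 2 ≤
        (((Finset.univ : Finset (Fin k)).powersetCard 2).filter
          fun T => (T ∩ W).card = 1).card / k.choose 2 := by
      gcongr
    refine le_trans ?_ (mul_le_mul_of_nonneg_right h3 (by positivity))
    rw [Nat.cast_choose_two]
    push_cast
    have h4 : (W.card / k : ℝ) * (η * ((k - W.card : ℕ) / k)) =
      ((W.card * (k - W.card : ℕ) : ℝ) / (k * k / 2)) * (η / ((0 + 2) * (0 + 1))) := by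
      field_simp; ring
    rw [h4]
    refine mul_le_mul_of_nonneg_right ?_ (by positivity)
    refine div_le_div_of_nonneg_left (by positivity) ?_ ?_
    · nlinarith
    · nlinarith

lemma insideProb_le (h0 : 0 ≤ η) (h1 : η ≤ 1) (hmk : m + 1 ≤ k) (P : Finset (Fin k)) :
    insideProb (adjustedSoliton (m + 1) η) P ≤
      (P.card / k : ℝ) * (1 - η + η / (m + 1) + η * (P.card / k)) := by
  classical
  have hk : (0 : ℝ) < k := by exact_mod_cast (by omega : 0 < k)
  have hPk : P.card ≤ k := by simpa using P.card_le_univ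
  have hPk' : (P.card : ℝ) / k ≤ 1 := by
    rw [div_le_one hk]; exact_mod_cast hPk
  have hratio : ∀ d ≤ k, ((((Finset.univ : Finset (Fin k)).powersetCard d).filter
      fun T => T.Nonempty ∧ T ⊆ P).card : ℝ) / k.choose d ≤ ((P.card : ℝ) / k) ^ d := by
    intro d hd
    refine le_trans ?_ (choose_div_choose_le_pow hPk hd)
    rw [← Finset.card_powersetCard d P]
    gcongr
    intro T hT
    obtain ⟨hT, hT'⟩ := Finset.mem_filter.1 hT
    exact Finset.mem_powersetCard.2 ⟨hT'.2, (Finset.mem_powersetCard.1 hT).2⟩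
  rw [insideProb, queryEventProb_adjustedSoliton hmk, mul_add ((P.card : ℝ) / k)]
  refine add_le_add ?_ ?_
  · refine mul_le_mul_of_nonneg_right ?_ (soliton_one_nonneg h0 h1 m)
    simpa using hratio 1 (by omega)
  · calc _ ≤ ∑ j ∈ Finset.range m, ((P.card : ℝ) / k) ^ 2 * (η / ((j + 2) * (j + 1))) := by
          refine Finset.sum_le_sum fun j hj => ?_
          rw [Finset.mem_range] at hj
          refine mul_le_mul_of_nonneg_right ?_ (by positivity)
          exact (hratio (j + 2) (by omega)).trans
            (pow_le_pow_of_le_one (by positivity) hPk' (by omega))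
      _ = ((P.card : ℝ) / k) ^ 2 * η *
          ∑ j ∈ Finset.range m, (1 : ℝ) / ((j + 2) * (j + 1)) := by
          rw [Finset.mul_sum]; exact Finset.sum_congr rfl fun j _ => by ring
      _ ≤ ((P.card : ℝ) / k) ^ 2 * η * 1 := by
          rw [sum_range_inv_mul]
          have : (0 : ℝ) ≤ 1 / ((m : ℝ) + 1) := by positivity
          gcongr
          linarith
      _ = _ := by ring

/-- Sets of more than half of the variables have an odd intersection with a query with probability
bounded below: degree three takes care of sets of almost all variables. -/
lemma le_oddHitProb (hm : 1 ≤ m) (hmk : m + 1 ≤ k) {W : Finset (Fin k)} (hW : k < 2 * W.card) :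
    1 / 24 ≤ oddHitProb (adjustedSoliton (m + 1) 1) W := by
  classical
  have hk : (0 : ℝ) < k := by exact_mod_cast (by omega : 0 < k)
  have hWk : W.card ≤ k := by simpa using W.card_le_univ
  have hβ : (1 : ℝ) / 2 ≤ W.card / k := by
    rw [le_div_iff₀ hk]
    have : (k : ℝ) < 2 * W.card := by exact_mod_cast hW
    linarith
  have hpk : ((k - W.card : ℕ) : ℝ) = k - W.card := Nat.cast_sub hWk
  have hb := (degree_le_two_le_singleHitProb zero_le_one le_rfl hm hmk W).trans
    (singleHitProb_le_oddHitProb (adjustedSoliton_nonneg zero_le_one le_rfl) W)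
  have hγ : (0 : ℝ) ≤ (k - W.card : ℕ) / k := by positivity
  rcases hm.eq_or_lt with rfl | hm2
  · refine le_trans ?_ hb
    norm_num at hγ ⊢
    nlinarith
  by_cases hp : (1 : ℝ) / 12 ≤ (k - W.card : ℕ) / k
  · refine le_trans ?_ hb
    have : (0 : ℝ) ≤ 1 / (m + 1) := by positivity
    nlinarith
  · rw [oddHitProb, queryEventProb_adjustedSoliton hmk]
    refine le_add_of_nonneg_of_le ?_ ?_
    · exact mul_nonneg (by positivity) (soliton_one_nonneg zero_le_one le_rfl m)
    refine le_trans ?_ (Finset.single_le_sum (fun j _ => by positivity)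
      (Finset.mem_range.2 hm2 : 1 ∈ Finset.range m))
    have hpos : (0 : ℝ) < k.choose 3 := by exact_mod_cast Nat.choose_pos (by omega)
    have h1 := one_sub_mul_choose_le k 3 (k - W.card) (by omega)
    rw [Nat.sub_sub_self hWk] at h1
    have h2 : W.card.choose 3 ≤ (((Finset.univ : Finset (Fin k)).powersetCard 3).filter
        fun T => Odd (T ∩ W).card).card := by
      rw [← Finset.card_powersetCard]
      refine Finset.card_le_card fun T hT => ?_
      obtain ⟨hT, hc⟩ := Finset.mem_powersetCard.1 hT
      refine Finset.mem_filter.2 ⟨Finset.mem_powersetCard.2 ⟨Finset.subset_univ _, hc⟩, ?_⟩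
      rw [Finset.inter_eq_left.2 hT, hc]
      decide
    have h3 : (1 : ℝ) - ((k - W.card : ℕ) : ℝ) * 3 / k ≤
        (((Finset.univ : Finset (Fin k)).powersetCard 3).filter
        fun T => Odd (T ∩ W).card).card / k.choose 3 := by
      rw [le_div_iff₀ hpos]
      refine le_trans (by exact_mod_cast h1) (by exact_mod_cast h2)
    refine le_trans ?_ (mul_le_mul_of_nonneg_right h3 (by positivity))
    have h4 : ((k - W.card : ℕ) : ℝ) * 3 / k = 3 * (((k - W.card : ℕ) : ℝ) / k) := by ring
    rw [h4]
    push Not at hp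
    norm_num
    linarith

end AdjustedSoliton

/-! ### Union bounds over sets of variables -/

section UnionBounds

variable {k m n : ℕ} {η δ : ℝ}

lemma choose_mul_pow_le_div_factorial (n p : ℕ) {s : ℝ} (hs : 0 ≤ s) :
    (n.choose p : ℝ) * s ^ p ≤ (n * s) ^ p / p.factorial := by
  have := mul_le_mul_of_nonneg_right (Nat.choose_le_pow_div (α := ℝ) p n) (pow_nonneg hs p)
  rw [mul_pow]
  exact this.trans_eq (by ring)

lemma choose_mul_div_pow_le_exp (p : ℕ) (hk : 0 < k) :
    (k.choose p : ℝ) * ((p : ℝ) / k) ^ p ≤ Real.exp p := by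
  have hk' : (k : ℝ) ≠ 0 := by exact_mod_cast hk.ne'
  refine (choose_mul_pow_le_div_factorial k p (by positivity)).trans ?_
  rw [mul_div_cancel₀ _ hk']
  exact Real.pow_div_factorial_le_exp _ (Nat.cast_nonneg _) p

lemma sum_finset_fin_eq (f : ℕ → ℝ) :
    ∑ W : Finset (Fin k), f W.card = ∑ w ∈ Finset.range (k + 1), (k.choose w : ℝ) * f w := by
  have := Finset.sum_powerset_apply_card f (x := (Finset.univ : Finset (Fin k)))
  simpa using this

lemma sum_half_pow_le (N : ℕ) : ∑ w ∈ Finset.range N, ((1 : ℝ) / 2) ^ w ≤ 2 :=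
  sum_geometric_two_le N

lemma sum_mul_half_pow_le (N : ℕ) : ∑ w ∈ Finset.range N, (w : ℝ) * ((1 : ℝ) / 2) ^ w ≤ 2 := by
  have h := hasSum_coe_mul_geometric_of_norm_lt_one (r := (1 / 2 : ℝ)) (by norm_num)
  have := sum_le_hasSum (Finset.range N) (fun w _ => by positivity) h
  norm_num at this ⊢
  exact this

lemma exp_neg_natCast_le (w : ℕ) : Real.exp (-(w : ℝ)) ≤ (1 / 2) ^ w := by
  have h : Real.exp (-(w : ℝ)) = Real.exp (-1) ^ w := by rw [← Real.exp_nat_mul]; ring_nf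
  rw [h]
  refine pow_le_pow_left₀ (Real.exp_nonneg _) ?_ w
  rw [Real.exp_neg, one_div]
  have := Real.add_one_le_exp (1 : ℝ)
  exact inv_anti₀ two_pos (by linarith)

/-- The union bound over all nonempty sets of variables: the binomial coefficient `k.choose w` is
at most `exp (w * (1 + log (k / w)))`. -/
lemma sum_nonempty_exp_le (hk : 0 < k) :
    ∑ W : Finset (Fin k) with 1 ≤ W.card,
      Real.exp (-(2 * (W.card * (1 + Real.log (k / W.card))))) ≤ 2 / k := by
  have hk' : (0 : ℝ) < k := by exact_mod_cast hk
  rw [Finset.sum_filter, sum_finset_fin_eq (fun w =>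
    if 1 ≤ w then Real.exp (-(2 * (w * (1 + Real.log (k / w))))) else 0)]
  have h : ∀ w ∈ Finset.range (k + 1), (k.choose w : ℝ) *
      (if 1 ≤ w then Real.exp (-(2 * (w * (1 + Real.log (k / w))))) else 0) ≤
      (w * (1 / 2) ^ w) * (1 / k) := by
    intro w hw
    split_ifs with h1
    · have hw0 : (0 : ℝ) < w := by exact_mod_cast h1
      have hwk : (w : ℝ) / k ≤ 1 := by
        rw [div_le_one hk']
        exact_mod_cast Nat.lt_succ_iff.1 (Finset.mem_range.1 hw)
      have hpos : (0 : ℝ) < (w : ℝ) / k := by positivity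
      have hlog : Real.log (k / w) = -Real.log (w / k) := by
        rw [← Real.log_inv, inv_div]
      have hexp : Real.exp (-(2 * (w * (1 + Real.log (k / w))))) =
          ((w : ℝ) / k) ^ w * (((w : ℝ) / k) ^ w * (Real.exp (-(w : ℝ)) * Real.exp (-(w : ℝ)))) := by
        conv_rhs => rw [← Real.exp_log hpos]
        rw [← Real.exp_nat_mul, ← Real.exp_add, ← Real.exp_add, ← Real.exp_add, hlog]
        congr 1; ring
      rw [hexp, ← mul_assoc]
      have hc := choose_mul_div_pow_le_exp w hk
      have hp : ((w : ℝ) / k) ^ w ≤ (w : ℝ) / k := by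
        simpa using pow_le_pow_of_le_one hpos.le hwk h1
      calc _ ≤ Real.exp w * (((w : ℝ) / k) ^ w * (Real.exp (-(w : ℝ)) * Real.exp (-(w : ℝ)))) := by
            gcongr
        _ = ((w : ℝ) / k) ^ w * Real.exp (-(w : ℝ)) := by
            rw [mul_left_comm, ← mul_assoc (Real.exp (w : ℝ)), ← Real.exp_add]
            simp
        _ ≤ (w : ℝ) / k * (1 / 2) ^ w := by gcongr; exact exp_neg_natCast_le w
        _ = _ := by ring
    · rw [mul_zero]; positivity
  refine (Finset.sum_le_sum h).trans ?_
  rw [← Finset.sum_mul, ← div_eq_mul_one_div]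
  gcongr
  exact sum_mul_half_pow_le _

/-- The number of queries is large enough to rule out all small stopping sets of more than
`δ k` elements. -/
lemma sparse_exponent_le (h0 : 0 ≤ η) (h1 : η ≤ 1) (hmk : m + 1 ≤ k) (hδ : 0 < δ)
    (hn1 : 100 * (k : ℝ) ≤ n * η)
    (hn2 : 100 * (k * Real.log (1 / δ)) ≤ n * η * ((harmonic (m + 1) : ℚ) - 1))
    {W : Finset (Fin k)} (hW : δ * k < W.card) (hWk : 2 * W.card ≤ k) :
    2 * (W.card * (1 + Real.log (k / W.card))) ≤
      n * singleHitProb (adjustedSoliton (m + 1) η) W := by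
  have hk : (0 : ℝ) < k := by exact_mod_cast (by omega : 0 < k)
  have hw : (0 : ℝ) < W.card := lt_trans (by positivity) hW
  have hw1 : 1 ≤ W.card := by exact_mod_cast hw
  have hWk' : 2 * (W.card : ℝ) ≤ k := by exact_mod_cast hWk
  set L := Real.log (k / W.card) with hL
  have hlog2 := Real.log_two_gt_d9
  have hlog2' := Real.log_two_lt_d9
  have hL2 : Real.log 2 ≤ L := Real.log_le_log two_pos (by rwa [le_div_iff₀ hw])
  set M := min m (k / (2 * W.card)) with hM
  have hMk : 2 * W.card * M ≤ k :=
    (Nat.mul_le_mul_left _ (min_le_right _ _)).trans (Nat.mul_div_le _ _)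
  have hq := harmonic_le_singleHitProb h0 h1 hmk hw1 (min_le_left _ _ : M ≤ m) hMk
  -- it suffices that the harmonic number dominates `log (k / |W|)`
  suffices h : 4 * (k * (1 + L)) ≤ n * η * (harmonic M : ℚ) by
    calc 2 * (W.card * (1 + L)) = (W.card / k : ℝ) / 2 * (4 * (k * (1 + L))) := by
          field_simp; ring
      _ ≤ (W.card / k : ℝ) / 2 * (n * η * (harmonic M : ℚ)) := by gcongr
      _ = n * ((W.card / k : ℝ) * η / 2 * (harmonic M : ℚ)) := by ring
      _ ≤ _ := by gcongr
  rcases min_choice m (k / (2 * W.card)) with h | h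
  · rw [hM, h]
    have h2 : ((harmonic (m + 1) : ℚ) : ℝ) - 1 ≤ (harmonic m : ℚ) := by
      rw [harmonic_succ]
      push_cast
      have : ((m : ℝ) + 1)⁻¹ ≤ 1 := by
        have : (0 : ℝ) ≤ m := Nat.cast_nonneg m
        exact inv_le_one_of_one_le₀ (by linarith)
      linarith
    have h3 : L ≤ Real.log (1 / δ) := by
      refine Real.log_le_log (by positivity) ?_
      rw [div_le_div_iff₀ hw hδ]
      linarith
    have h4 : n * η * ((harmonic (m + 1) : ℚ) - 1) ≤ n * η * (harmonic m : ℚ) := by gcongr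
    have h5 : k * L ≤ k * Real.log (1 / δ) := by gcongr
    nlinarith
  · rw [hM, h]
    set q := k / (2 * W.card) with hqdef
    have h2 : L - Real.log 2 ≤ Real.log (q + 1 : ℕ) := by
      rw [hL, ← Real.log_div (by positivity) two_ne_zero]
      refine Real.log_le_log (by positivity) ?_
      rw [div_div, div_le_iff₀ (by positivity)]
      have : k < (q + 1) * (2 * W.card) := by
        have := Nat.lt_div_mul_add (a := k) (by omega : 0 < 2 * W.card)
        rw [← hqdef] at this
        linarith
      have h5 : (k : ℝ) < ((q + 1 : ℕ) : ℝ) * (2 * W.card) := by exact_mod_cast this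
      linarith
    have h3 : Real.log 2 ≤ Real.log (q + 1 : ℕ) := by
      refine Real.log_le_log two_pos ?_
      have : 1 ≤ q := (Nat.one_le_div_iff (by omega)).2 hWk
      exact_mod_cast (by omega : 2 ≤ q + 1)
    have h4 := log_add_one_le_harmonic q
    have h5 : 100 * k * (harmonic q : ℚ) ≤ n * η * (harmonic q : ℚ) := by
      have : (0 : ℝ) ≤ (harmonic q : ℚ) := by linarith
      gcongr
    have h6 : 1 + L ≤ 4 * ((harmonic q : ℚ) : ℝ) := by linarith
    nlinarith

lemma sum_sparse_le (hk : 0 < k) (hδ : 0 < δ) {f : Finset (Fin k) → ℝ}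
    (hf : ∀ W : Finset (Fin k), δ * k < W.card → 2 * W.card ≤ k →
      2 * (W.card * (1 + Real.log (k / W.card))) ≤ f W) :
    ∑ W : Finset (Fin k) with δ * k < W.card ∧ 2 * W.card ≤ k, Real.exp (-f W) ≤ 2 / k := by
  refine le_trans ?_ (sum_nonempty_exp_le hk)
  refine le_trans (Finset.sum_le_sum fun W hW => ?_)
    (Finset.sum_le_sum_of_subset_of_nonneg ?_ fun W _ _ => Real.exp_nonneg _)
  · have := (Finset.mem_filter.1 hW).2
    exact Real.exp_le_exp.2 (neg_le_neg (hf W this.1 this.2))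
  · intro W hW
    have h := (Finset.mem_filter.1 hW).2.1
    have hk' : (0 : ℝ) < k := by exact_mod_cast hk
    have : (0 : ℝ) < W.card := lt_trans (by positivity) h
    exact Finset.mem_filter.2 ⟨Finset.mem_univ _, by exact_mod_cast this⟩

/-- The trade-off that rules out small sets of recovered variables: with `x = n s / p` the left
side is at most `(e ^ 2 x exp (-x / 4)) ^ p`, and `x` is at least the constant `100`. -/
lemma choose_mul_choose_mul_exp_le {p : ℕ} {s : ℝ} (hk : 0 < k) (hs : 0 ≤ s)
    (hp : 100 * (p : ℝ) ≤ n * s) :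
    (k.choose p : ℝ) * (n.choose p * ((p / k : ℝ) * s) ^ p * Real.exp (-(n * s / 4))) ≤
      Real.exp (-(n * s / 8)) := by
  have h1 := choose_mul_div_pow_le_exp p hk
  have h2 : (n.choose p : ℝ) * s ^ p ≤ Real.exp (3 * p + n * s / 16) := by
    refine (choose_mul_pow_le_div_factorial n p hs).trans ?_
    have h3 := Real.pow_div_factorial_le_exp (n * s / 16) (by positivity) p
    have h16 : (16 : ℝ) ^ p ≤ Real.exp (3 * p) := by
      rw [mul_comm, Real.exp_nat_mul]
      gcongr
      have h := Real.exp_one_gt_d9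
      have : Real.exp 3 = Real.exp 1 ^ 3 := by rw [← Real.exp_nat_mul]; norm_num
      rw [this]
      calc (16 : ℝ) ≤ 2.7 ^ 3 := by norm_num
        _ ≤ _ := by gcongr; linarith
    calc (n * s) ^ p / p.factorial = 16 ^ p * ((n * s / 16) ^ p / p.factorial) := by
          rw [div_pow]; field_simp
      _ ≤ Real.exp (3 * p) * Real.exp (n * s / 16) := by gcongr
      _ = _ := (Real.exp_add _ _).symm
  calc (k.choose p : ℝ) * (n.choose p * ((p / k : ℝ) * s) ^ p * Real.exp (-(n * s / 4)))
      = ((k.choose p : ℝ) * ((p : ℝ) / k) ^ p) * (n.choose p * s ^ p) *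
          Real.exp (-(n * s / 4)) := by rw [mul_pow]; ring
    _ ≤ Real.exp p * Real.exp (3 * p + n * s / 16) * Real.exp (-(n * s / 4)) := by gcongr
    _ = Real.exp (p + (3 * p + n * s / 16) + -(n * s / 4)) := by
      rw [← Real.exp_add, ← Real.exp_add]
    _ ≤ _ := by
      apply Real.exp_le_exp.2
      have : (0 : ℝ) ≤ p := Nat.cast_nonneg p
      linarith

/-- It is unlikely that BP gets stuck before half of the variables are recovered, provided that
there are many queries of degree one. -/
lemma sum_stuck_le (h0 : 0 ≤ η) (h1 : η ≤ 1) (hm : 1 ≤ m) (hmk : m + 1 ≤ k)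
    (hn : 100 * (k : ℝ) ≤ n) :
    ∑ P : Finset (Fin k) with 2 * P.card < k,
        n.choose P.card * insideProb (adjustedSoliton (m + 1) η) P ^ P.card *
          Real.exp (-((n - P.card : ℕ) * singleHitProb (adjustedSoliton (m + 1) η) Pᶜ)) ≤
      2 * Real.exp (-(n * (1 - η + η / (m + 1)) / 16)) := by
  have hk0 : 0 < k := by omega
  have hk : (0 : ℝ) < k := by exact_mod_cast hk0
  set o := 1 - η + η / ((m : ℝ) + 1) with ho
  have ho0 : 0 ≤ o := soliton_one_nonneg h0 h1 m
  have ho1 : 1 - η ≤ o := by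
    have : 0 ≤ η / ((m : ℝ) + 1) := by positivity
    linarith
  let s : ℕ → ℝ := fun p => o + η * (p / k)
  have hs0 : ∀ p, 0 ≤ s p := fun p => by positivity
  let F : ℕ → ℝ := fun p => if 2 * p < k then
    n.choose p * ((p / k : ℝ) * s p) ^ p * Real.exp (-(n * s p / 4)) else 0
  have hstep : ∑ P : Finset (Fin k) with 2 * P.card < k,
        n.choose P.card * insideProb (adjustedSoliton (m + 1) η) P ^ P.card *
          Real.exp (-((n - P.card : ℕ) * singleHitProb (adjustedSoliton (m + 1) η) Pᶜ)) ≤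
      ∑ P : Finset (Fin k), F P.card := by
    rw [Finset.sum_filter]
    refine Finset.sum_le_sum fun P _ => ?_
    by_cases hP : 2 * P.card < k
    · simp only [F, hP, if_true]
      have hPk : P.card ≤ k := by omega
      have hin : insideProb (adjustedSoliton (m + 1) η) P ≤ (P.card / k : ℝ) * s P.card :=
        insideProb_le h0 h1 hmk P
      have hin0 : 0 ≤ insideProb (adjustedSoliton (m + 1) η) P :=
        queryEventProb_nonneg (adjustedSoliton_nonneg h0 h1) _
      have hsing := degree_le_two_le_singleHitProb h0 h1 hm hmk Pᶜ
      rw [Finset.card_compl, Fintype.card_fin, Nat.sub_sub_self hPk] at hsing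
      have hhalf : (1 : ℝ) / 2 ≤ ((k - P.card : ℕ) : ℝ) / k := by
        rw [le_div_iff₀ hk, Nat.cast_sub hPk]
        have : 2 * (P.card : ℝ) < k := by exact_mod_cast hP
        linarith
      have hsing2 : s P.card / 2 ≤ singleHitProb (adjustedSoliton (m + 1) η) Pᶜ := by
        refine le_trans ?_ hsing
        have := mul_le_mul_of_nonneg_right hhalf (hs0 P.card)
        exact le_trans (by linarith) this
      have hkn : P.card ≤ n := by
        have : (P.card : ℝ) ≤ n := by
          have : (P.card : ℝ) ≤ k := by exact_mod_cast hPk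
          linarith
        exact_mod_cast this
      have hnp : (n : ℝ) / 2 ≤ ((n - P.card : ℕ) : ℝ) := by
        rw [Nat.cast_sub hkn]
        have : (P.card : ℝ) ≤ k := by exact_mod_cast hPk
        linarith
      gcongr
      calc n * s P.card / 4 = (n : ℝ) / 2 * (s P.card / 2) := by ring
        _ ≤ _ := mul_le_mul hnp hsing2 (by have := hs0 P.card; linarith) (Nat.cast_nonneg _)
    · simp [F, hP]
  refine hstep.trans ?_
  rw [sum_finset_fin_eq F]
  have hterm : ∀ p ∈ Finset.range (k + 1), (k.choose p : ℝ) * F p ≤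
      Real.exp (-(n * o / 16)) * (1 / 2) ^ p := by
    intro p hp
    have hpk : (p : ℝ) / k ≤ 1 := by
      rw [div_le_one hk]
      exact_mod_cast Nat.lt_succ_iff.1 (Finset.mem_range.1 hp)
    simp only [F]
    split_ifs with h
    · have hps : (p : ℝ) / k ≤ s p := by
        have : (1 - η) * ((p : ℝ) / k) ≤ o :=
          (mul_le_of_le_one_right (by linarith) hpk).trans ho1
        simp only [s]
        linarith
      have hnp : 100 * (p : ℝ) ≤ n * s p := by
        calc 100 * (p : ℝ) = 100 * k * (p / k) := by field_simp
          _ ≤ n * s p := by gcongr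
      refine (choose_mul_choose_mul_exp_le hk0 (hs0 p) hnp).trans ?_
      have hos : n * o ≤ n * s p := by
        have : 0 ≤ η * ((p : ℝ) / k) := by positivity
        gcongr
        simp only [s]; linarith
      calc Real.exp (-(n * s p / 8)) ≤ Real.exp (-(n * o / 16) + -(p : ℝ)) := by
            apply Real.exp_le_exp.2
            have : (0 : ℝ) ≤ p := Nat.cast_nonneg p
            linarith
        _ = Real.exp (-(n * o / 16)) * Real.exp (-(p : ℝ)) := Real.exp_add _ _
        _ ≤ _ := by gcongr; exact exp_neg_natCast_le p
    · rw [mul_zero]; positivity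
  refine (Finset.sum_le_sum hterm).trans ?_
  rw [← Finset.mul_sum, mul_comm]
  gcongr
  exact sum_half_pow_le _

/-- Nonasymptotic bound on the error of BP. -/
lemma bpError_adjustedSoliton_le (h0 : 0 ≤ η) (h1 : η ≤ 1) (hm : 1 ≤ m) (hmk : m + 1 ≤ k)
    (hδ : 0 < δ) (hn1 : 100 * (k : ℝ) ≤ n * η)
    (hn2 : 100 * (k * Real.log (1 / δ)) ≤ n * η * ((harmonic (m + 1) : ℚ) - 1)) :
    bpError (adjustedSoliton (m + 1) η) k n (1 - δ) ≤
      2 / k + 2 * Real.exp (-(n * (1 - η + η / (m + 1)) / 16)) := by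
  refine (bpError_le (adjustedSoliton_nonneg h0 h1) (sum_adjustedSoliton hmk η) δ).trans ?_
  refine add_le_add ?_ (sum_stuck_le h0 h1 hm hmk ?_)
  · exact sum_sparse_le (by omega) hδ
      fun W hW hWk => sparse_exponent_le h0 h1 hmk hδ hn1 hn2 hW hWk
  · exact hn1.trans (mul_le_of_le_one_right (Nat.cast_nonneg n) h1)

/-- Nonasymptotic bound on the error of the best estimator. -/
lemma optimalError_soliton_le (hm : 1 ≤ m) (hmk : m + 1 ≤ k) (hδ : 0 < δ)
    (hn1 : 100 * (k : ℝ) ≤ n)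
    (hn2 : 100 * (k * Real.log (1 / δ)) ≤ n * ((harmonic (m + 1) : ℚ) - 1)) :
    optimalError (adjustedSoliton (m + 1) 1) k n (1 - δ) ≤ 3 / k := by
  have hk0 : 0 < k := by omega
  have hk : (0 : ℝ) < k := by exact_mod_cast hk0
  have hΩ := adjustedSoliton_nonneg (D := m + 1) zero_le_one (le_refl (1 : ℝ))
  refine (optimalError_le hΩ (sum_adjustedSoliton hmk 1) hk0 δ).trans ?_
  rw [← Finset.sum_filter_add_sum_filter_not _ (fun W : Finset (Fin k) => 2 * W.card ≤ k),
    Finset.filter_filter, (by ring : (3 : ℝ) / k = 2 / k + 1 / k)]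
  refine add_le_add (sum_sparse_le hk0 hδ fun W hW hWk => ?_) ?_
  · refine (sparse_exponent_le zero_le_one le_rfl hmk hδ (by simpa using hn1)
      (by simpa using hn2) hW hWk).trans ?_
    gcongr
    exact singleHitProb_le_oddHitProb hΩ W
  · refine (Finset.sum_le_card_nsmul _ _ (Real.exp (-(2 * k))) fun W hW => ?_).trans ?_
    · have hW2 := (Finset.mem_filter.1 hW).2
      have := le_oddHitProb hm hmk (by omega : k < 2 * W.card)
      apply Real.exp_le_exp.2
      nlinarith
    · rw [nsmul_eq_mul]
      have h2 : (((Finset.univ.filter fun W : Finset (Fin k) => δ * k < W.card).filter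
          fun W => ¬ 2 * W.card ≤ k).card : ℝ) ≤ Real.exp k := by
        calc _ ≤ ((Finset.univ : Finset (Finset (Fin k))).card : ℝ) := by
              exact_mod_cast Finset.card_le_univ _
          _ = 2 ^ k := by simp
          _ ≤ Real.exp 1 ^ k := by
              gcongr
              have := Real.add_one_le_exp (1 : ℝ)
              linarith
          _ = Real.exp k := by rw [← Real.exp_nat_mul, mul_one]
      calc _ ≤ Real.exp k * Real.exp (-(2 * k)) := by gcongr
        _ = (Real.exp k)⁻¹ := by rw [← Real.exp_add, ← Real.exp_neg]; congr 1; ring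
        _ ≤ (k : ℝ)⁻¹ := by
            refine inv_anti₀ hk ?_
            have := Real.add_one_le_exp (k : ℝ)
            linarith
        _ = 1 / k := (one_div _).symm

end UnionBounds

/-! ### Queries of degree one -/

section UnitDegree

variable {k n : ℕ} {δ : ℝ}

lemma unitDegree_eq_adjustedSoliton : unitDegree = adjustedSoliton 1 0 := by
  funext d; simp [unitDegree, adjustedSoliton]

/-- The coupon collector bound: Markov's inequality for the number of variables that no query
asks for. -/
lemma bpError_unitDegree_le (hk : 0 < k) (hδ : 0 < δ) :
    bpError unitDegree k n (1 - δ) ≤ Real.exp (-(n / k)) / δ := by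
  classical
  have hk' : (0 : ℝ) < k := by exact_mod_cast hk
  have hΩ : ∀ d, 0 ≤ unitDegree d := by
    rw [unitDegree_eq_adjustedSoliton]; exact adjustedSoliton_nonneg le_rfl zero_le_one
  have hsum : ∑ d ∈ Finset.range (k + 1), unitDegree d = 1 := by
    rw [unitDegree_eq_adjustedSoliton]
    exact sum_adjustedSoliton (m := 0) hk 0
  refine ciSup_le fun x => ?_
  rw [le_div_iff₀ hδ]
  refine le_of_mul_le_mul_right ?_ hk'
  have h1 := mul_designProb_le_sum (n := n) hΩ (Finset.univ : Finset (Fin k))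
    (E := fun G : Design k n => ((Finset.univ.filter fun i =>
      bpDecode G (answers G x) i = some (x i)).card : ℝ) < (1 - δ) * k)
    (F := fun i G => ∀ a, ¬ G a = {i}) (δ * k) (by
      intro G hG
      have hG' : ((bpRecovered G x).card : ℝ) < (1 - δ) * k := hG
      refine ⟨(bpRecovered G x)ᶜ, Finset.subset_univ _, ?_, fun i hi a ha => ?_⟩
      · have := (bpRecovered G x).card_le_univ
        rw [Finset.card_compl, Nat.cast_sub this, Fintype.card_fin]
        linarith
      · apply card_inter_compl_bpRecovered_ne_one G x a
        rw [ha, Finset.singleton_inter_of_mem hi, Finset.card_singleton])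
  have h2 : ∀ i : Fin k, designProb unitDegree (fun G : Design k n => ∀ a, ¬ G a = {i}) ≤
      Real.exp (-(n / k)) := by
    intro i
    refine (designProb_forall_not_le_exp hΩ hsum fun T => T = {i}).trans ?_
    apply Real.exp_le_exp.2
    apply neg_le_neg
    have h3 : queryProb unitDegree ({i} : Finset (Fin k)) = 1 / k := by
      simp [queryProb, unitDegree]
    have h4 : 1 / (k : ℝ) ≤ queryEventProb unitDegree (fun T : Finset (Fin k) => T = {i}) := by
      rw [← h3]
      exact Finset.single_le_sum (fun T _ => queryProb_nonneg hΩ T) (by simp)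
    rw [div_eq_mul_one_div]
    gcongr
  calc designProb unitDegree _ * δ * k = δ * k * designProb unitDegree _ := by ring
    _ ≤ _ := h1
    _ ≤ _ := Finset.sum_le_sum fun i _ => h2 i
    _ = _ := by simp [mul_comm]

end UnitDegree

/-! ### Asymptotics -/

lemma bpError_nonneg {Ω : ℕ → ℝ} (hΩ : ∀ d, 0 ≤ Ω d) (k n : ℕ) (α : ℝ) :
    0 ≤ bpError Ω k n α :=
  Real.iSup_nonneg fun _ => designProb_nonneg hΩ _

lemma optimalError_nonneg {Ω : ℕ → ℝ} (hΩ : ∀ d, 0 ≤ Ω d) (k n : ℕ) (α : ℝ) :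
    0 ≤ optimalError Ω k n α :=
  Real.iInf_nonneg fun _ => Real.iSup_nonneg fun _ => designProb_nonneg hΩ _

lemma one_lt_harmonic {m : ℕ} (hm : 1 ≤ m) : (1 : ℝ) < ((harmonic (m + 1) : ℚ) : ℝ) := by
  have h : (3 / 2 : ℝ) ≤ ((harmonic (m + 1) : ℚ) : ℝ) := by
    rw [harmonic_cast]
    refine le_trans (le_of_eq ?_) (Finset.sum_le_sum_of_subset_of_nonneg
      (Finset.range_mono (by omega : 2 ≤ m + 1)) fun j _ _ => by positivity)
    norm_num [Finset.sum_range_succ]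
  linarith

lemma tendsto_const_div_add_exp {a : ℝ} {u : ℕ → ℝ} (hu : Tendsto u atTop atTop) :
    Tendsto (fun k : ℕ => a / (k : ℝ) + 2 * Real.exp (-u k)) atTop (𝓝 0) := by
  have h1 : Tendsto (fun k : ℕ => a / (k : ℝ)) atTop (𝓝 0) :=
    tendsto_const_div_atTop_nhds_zero_nat a
  have h2 := (Real.tendsto_exp_neg_atTop_nhds_zero.comp hu).const_mul 2
  simpa using h1.add h2

section Soliton

variable {k D n : ℕ} {δ : ℝ}

lemma soliton_queries_bounds (hD : 2 ≤ D) (hDk : D ≤ k)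
    (hn : 100 * max (k : ℝ) ((k : ℝ) * Real.log (1 / δ) /
      (queryDifficulty (soliton D) k - 1)) ≤ n) :
    100 * (k : ℝ) ≤ n ∧
      100 * (k * Real.log (1 / δ)) ≤ n * (((harmonic D : ℚ) : ℝ) - 1) := by
  obtain ⟨m, rfl⟩ : ∃ m, D = m + 1 := ⟨D - 1, by omega⟩
  rw [soliton_eq_adjustedSoliton, queryDifficulty_adjustedSoliton hDk, one_mul,
    add_sub_cancel_left] at hn
  have hH := one_lt_harmonic (by omega : 1 ≤ m)
  have h1 := (mul_le_mul_of_nonneg_left (le_max_left _ _) (by norm_num)).trans hn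
  have h2 := (mul_le_mul_of_nonneg_left (le_max_right _ _) (by norm_num)).trans hn
  refine ⟨h1, ?_⟩
  rw [← mul_div_assoc, div_le_iff₀ (by linarith)] at h2
  exact h2

lemma optimalError_soliton_le_three_div (hD : 2 ≤ D) (hDk : D ≤ k) (hδ : 0 < δ)
    (hn : 100 * max (k : ℝ) ((k : ℝ) * Real.log (1 / δ) /
      (queryDifficulty (soliton D) k - 1)) ≤ n) :
    optimalError (soliton D) k n (1 - δ) ≤ 3 / k := by
  obtain ⟨h1, h2⟩ := soliton_queries_bounds hD hDk hn
  obtain ⟨m, rfl⟩ : ∃ m, D = m + 1 := ⟨D - 1, by omega⟩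
  rw [soliton_eq_adjustedSoliton]
  exact optimalError_soliton_le (by omega) hDk hδ h1 h2

lemma bpError_soliton_le (hD : 2 ≤ D) (hDk : D ≤ k) (hδ : 0 < δ)
    (hn : 100 * max (k : ℝ) ((k : ℝ) * Real.log (1 / δ) /
      (queryDifficulty (soliton D) k - 1)) ≤ n) :
    bpError (soliton D) k n (1 - δ) ≤ 2 / k + 2 * Real.exp (-((D : ℝ) / k)⁻¹) := by
  obtain ⟨h1, h2⟩ := soliton_queries_bounds hD hDk hn
  obtain ⟨m, rfl⟩ : ∃ m, D = m + 1 := ⟨D - 1, by omega⟩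
  rw [soliton_eq_adjustedSoliton]
  refine (bpError_adjustedSoliton_le zero_le_one le_rfl (by omega) hDk hδ (by simpa using h1)
    (by simpa using h2)).trans ?_
  gcongr
  rw [inv_div, sub_self, zero_add, mul_one_div, div_div, div_le_div_iff₀ (by positivity)
    (by positivity)]
  push_cast
  have : (0 : ℝ) ≤ (m : ℝ) + 1 := by positivity
  nlinarith

/-- The requirement that the query difficulty is less than `log (1 / δ)` leaves a weight
`1 - η` of order at least `1 / log k` for the queries of degree one. -/
lemma bpError_adjustedSoliton_le_of_queryDifficulty {d η : ℝ} (hk : 1 / (k : ℝ) ≤ δ)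
    (hk0 : 0 < k) (hδ2 : δ ≤ 1 / 2) (hd1 : 1 < d) (hd2 : d < Real.log (1 / δ))
    (hd : queryDifficulty (adjustedSoliton ⌊1 / δ⌋₊ η) k = d)
    (hn : 100 * max (k : ℝ) ((k : ℝ) * Real.log (1 / δ) / (d - 1)) ≤ n) :
    0 ≤ bpError (adjustedSoliton ⌊1 / δ⌋₊ η) k n (1 - δ) ∧
    bpError (adjustedSoliton ⌊1 / δ⌋₊ η) k n (1 - δ) ≤
      2 / k + 2 * Real.exp (-(√k / 2)) := by
  have hkR : (0 : ℝ) < k := by exact_mod_cast hk0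
  have hδ : 0 < δ := lt_of_lt_of_le (by positivity) hk
  have hδk : 1 / δ ≤ k := by rwa [one_div_le hδ hkR]
  have hδ2' : (2 : ℝ) ≤ 1 / δ := by rw [le_div_iff₀ hδ]; linarith
  have hD2 : 2 ≤ ⌊1 / δ⌋₊ := Nat.le_floor (by exact_mod_cast hδ2')
  have hDδ : (⌊1 / δ⌋₊ : ℝ) ≤ 1 / δ := Nat.floor_le (by positivity)
  have hDk : ⌊1 / δ⌋₊ ≤ k := by exact_mod_cast hDδ.trans hδk
  have hlt : 1 / δ < (⌊1 / δ⌋₊ : ℝ) + 1 := Nat.lt_floor_add_one _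
  generalize ⌊1 / δ⌋₊ = D at *
  obtain ⟨m, rfl⟩ : ∃ m, D = m + 1 := ⟨D - 1, by omega⟩
  have hm1 : 1 ≤ m := by omega
  rw [queryDifficulty_adjustedSoliton hDk] at hd
  set H : ℝ := ((harmonic (m + 1) : ℚ) : ℝ) with hH
  have hH1 : 1 < H := one_lt_harmonic hm1
  have hη0 : 0 < η := pos_of_mul_pos_left (by linarith : 0 < η * (H - 1)) (by linarith)
  have hlog2 := Real.log_two_lt_d9
  -- `H - log (m + 2)` increases to Euler's constant, starting from `1 - log 2`
  have hgap : 0.3 ≤ H - d := by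
    have h1 := Real.strictMono_eulerMascheroniSeq.monotone (by omega : 1 ≤ m + 1)
    simp only [Real.eulerMascheroniSeq] at h1
    have h2 : Real.log (1 / δ) ≤ Real.log (((m + 1 : ℕ) : ℝ) + 1) :=
      Real.log_le_log (by positivity) hlt.le
    norm_num [harmonic] at h1
    have h3 : H = ∑ i ∈ Finset.range (m + 1), ((i : ℝ) + 1)⁻¹ := by simp [hH, harmonic]
    push_cast at h2
    rw [← h3] at h1
    linarith
  have hlogD : H - 1 ≤ Real.log ((m + 1 : ℕ) : ℝ) := by
    have := harmonic_le_one_add_log (m + 1)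
    linarith
  have hlogδ : Real.log ((m + 1 : ℕ) : ℝ) ≤ Real.log (1 / δ) :=
    Real.log_le_log (by positivity) hDδ
  have hlogk : Real.log (1 / δ) ≤ 2 * √k := by
    have h1 := Real.log_le_log (by positivity) hδk
    have h2 := Real.log_le_sub_one_of_pos (Real.sqrt_pos.2 hkR)
    rw [Real.log_sqrt hkR.le] at h2
    linarith
  have hη1' : 0.3 ≤ (1 - η) * (H - 1) := by linarith
  have hη1 : 0 ≤ 1 - η := (pos_of_mul_pos_left (by linarith : 0 < (1 - η) * (H - 1))
    (by linarith)).le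
  have hn1 : 100 * (k : ℝ) ≤ n := (mul_le_mul_of_nonneg_left (le_max_left _ _)
    (by norm_num)).trans hn
  have hn2 : 100 * (k * Real.log (1 / δ)) ≤ n * η * (H - 1) := by
    have h2 := (mul_le_mul_of_nonneg_left (le_max_right _ _) (by norm_num)).trans hn
    rw [← mul_div_assoc, div_le_iff₀ (by linarith)] at h2
    calc _ ≤ _ := h2
      _ = _ := by rw [← hd]; ring
  have hn3 : 100 * (k : ℝ) ≤ n * η := by
    refine le_of_mul_le_mul_right ?_ (by linarith : 0 < Real.log (1 / δ))
    calc 100 * (k : ℝ) * Real.log (1 / δ) = 100 * (k * Real.log (1 / δ)) := by ring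
      _ ≤ n * η * (H - 1) := hn2
      _ ≤ _ := by gcongr; linarith
  refine ⟨bpError_nonneg (adjustedSoliton_nonneg hη0.le (by linarith)) _ _ _, ?_⟩
  refine (bpError_adjustedSoliton_le hη0.le (by linarith) hm1 hDk hδ hn3 hn2).trans ?_
  have hs : √k * √k = k := Real.mul_self_sqrt hkR.le
  have hs0 : 0 < √k := Real.sqrt_pos.2 hkR
  have h4 : 0.15 ≤ (1 - η) * √k := by
    have : (1 - η) * (H - 1) ≤ (1 - η) * (2 * √k) := by gcongr; linarith
    linarith
  have h5 : 15 * √k ≤ n * (1 - η) := by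
    calc 15 * √k = 100 * √k * 0.15 := by ring
      _ ≤ 100 * √k * ((1 - η) * √k) := by gcongr
      _ = 100 * k * (1 - η) := by
        linear_combination (100 * (1 - η)) * hs
      _ ≤ n * (1 - η) := by gcongr
  have h6 : n * (1 - η) ≤ n * (1 - η + η / (m + 1)) := by
    have : 0 ≤ η / ((m : ℝ) + 1) := by positivity
    gcongr
    linarith
  have h7 : √k / 2 ≤ n * (1 - η + η / (m + 1)) / 16 := by linarith
  gcongr

end Soliton

lemma eventually_pos_of_one_div_le {δ : ℕ → ℝ} (h : ∀ᶠ k : ℕ in atTop, 1 / (k : ℝ) ≤ δ k) :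
    ∀ᶠ k : ℕ in atTop, 0 < k ∧ 0 < δ k := by
  filter_upwards [h, eventually_gt_atTop 0] with k h1 hk
  have : (0 : ℝ) < k := by exact_mod_cast hk
  exact ⟨hk, lt_of_lt_of_le (by positivity) h1⟩

theorem theorem3 :
    (∃ c : ℝ, 0 < c ∧
      ∀ δ : ℕ → ℝ, Tendsto δ atTop (𝓝 0) → (∀ᶠ k : ℕ in atTop, 1 / (k : ℝ) ≤ δ k) →
        -- soliton distribution with maximum degree `D`
        (∀ D n : ℕ → ℕ,
          (∀ᶠ k : ℕ in atTop, 2 ≤ D k ∧ D k ≤ k) →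
          (∀ᶠ k : ℕ in atTop,
            c * max (k : ℝ) ((k : ℝ) * Real.log (1 / δ k) /
              (queryDifficulty (soliton (D k)) k - 1)) ≤ (n k : ℝ)) →
          Tendsto (fun k : ℕ => optimalError (soliton (D k)) k (n k) (1 - δ k)) atTop (𝓝 0) ∧
          (Tendsto (fun k : ℕ => (D k : ℝ) / (k : ℝ)) atTop (𝓝 0) →
            Tendsto (fun k : ℕ => bpError (soliton (D k)) k (n k) (1 - δ k)) atTop (𝓝 0))) ∧
        -- prescribed query difficulty below `log (1/δ)`: adjusted soliton distribution
        (∀ (d η : ℕ → ℝ) (n : ℕ → ℕ),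
          (∀ᶠ k : ℕ in atTop, 1 < d k ∧ d k < Real.log (1 / δ k)) →
          (∀ᶠ k : ℕ in atTop, queryDifficulty (adjustedSoliton ⌊1 / δ k⌋₊ (η k)) k = d k) →
          (∀ᶠ k : ℕ in atTop,
            c * max (k : ℝ) ((k : ℝ) * Real.log (1 / δ k) / (d k - 1)) ≤ (n k : ℝ)) →
          Tendsto (fun k : ℕ =>
            bpError (adjustedSoliton ⌊1 / δ k⌋₊ (η k)) k (n k) (1 - δ k)) atTop (𝓝 0))) ∧
    -- query difficulty one
    (∀ ε : ℝ, 0 < ε →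
      ∀ δ : ℕ → ℝ, Tendsto δ atTop (𝓝 0) → (∀ᶠ k : ℕ in atTop, 1 / (k : ℝ) ≤ δ k) →
        ∀ n : ℕ → ℕ,
          (∀ᶠ k : ℕ in atTop, (1 + ε) * (k : ℝ) * Real.log (1 / δ k) ≤ (n k : ℝ)) →
          Tendsto (fun k : ℕ => bpError unitDegree k (n k) (1 - δ k)) atTop (𝓝 0)) := by
  refine ⟨⟨100, by norm_num, fun δ hδ hδk => ⟨fun D n hD hn => ⟨?_, fun hDk => ?_⟩,
    fun d η n hd hdη hn => ?_⟩⟩, fun ε hε δ hδ hδk n hn => ?_⟩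
  · refine squeeze_zero' (Eventually.of_forall fun k => ?_) ?_
      (tendsto_const_div_atTop_nhds_zero_nat 3)
    · rw [soliton_eq_adjustedSoliton]
      exact optimalError_nonneg (adjustedSoliton_nonneg zero_le_one le_rfl) _ _ _
    · filter_upwards [hD, hn, eventually_pos_of_one_div_le hδk] with k hD hn hδ
      exact optimalError_soliton_le_three_div hD.1 hD.2 hδ.2 hn
  · have hu : Tendsto (fun k : ℕ => ((D k : ℝ) / k)⁻¹) atTop atTop := by
      refine tendsto_inv_nhdsGT_zero.comp (tendsto_nhdsWithin_iff.2 ⟨hDk, ?_⟩)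
      filter_upwards [hD] with k hD
      have h1 : (0 : ℝ) < D k := by exact_mod_cast (by omega : 0 < D k)
      have h2 : (0 : ℝ) < k := by exact_mod_cast (by omega : 0 < k)
      exact div_pos h1 h2
    refine squeeze_zero' (Eventually.of_forall fun k => ?_) ?_ (tendsto_const_div_add_exp (a := 2) hu)
    · rw [soliton_eq_adjustedSoliton]
      exact bpError_nonneg (adjustedSoliton_nonneg zero_le_one le_rfl) _ _ _
    · filter_upwards [hD, hn, eventually_pos_of_one_div_le hδk] with k hD hn hδ
      exact bpError_soliton_le hD.1 hD.2 hδ.2 hn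
  · have hu : Tendsto (fun k : ℕ => √(k : ℝ) / 2) atTop atTop :=
      (Real.tendsto_sqrt_atTop.comp tendsto_natCast_atTop_atTop).atTop_div_const two_pos
    have hall : ∀ᶠ k : ℕ in atTop,
        0 ≤ bpError (adjustedSoliton ⌊1 / δ k⌋₊ (η k)) k (n k) (1 - δ k) ∧
        bpError (adjustedSoliton ⌊1 / δ k⌋₊ (η k)) k (n k) (1 - δ k) ≤
          2 / k + 2 * Real.exp (-(√k / 2)) := by
      filter_upwards [hd, hdη, hn, hδk, eventually_pos_of_one_div_le hδk,
        hδ.eventually_le_const (by norm_num : (0 : ℝ) < 1 / 2)] with k h1 h2 h3 h4 h5 h6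
      exact bpError_adjustedSoliton_le_of_queryDifficulty h4 h5.1 h6 h1.1 h1.2 h2 h3
    exact squeeze_zero' (hall.mono fun k h => h.1) (hall.mono fun k h => h.2)
      (tendsto_const_div_add_exp hu)
  · have hpos := eventually_pos_of_one_div_le hδk
    have hlog : Tendsto (fun k : ℕ => ε * Real.log (1 / δ k)) atTop atTop := by
      have h1 : Tendsto (fun k : ℕ => (δ k)⁻¹) atTop atTop :=
        tendsto_inv_nhdsGT_zero.comp (tendsto_nhdsWithin_iff.2 ⟨hδ, hpos.mono fun k h => h.2⟩)
      simpa only [one_div, Function.comp_def] using (Real.tendsto_log_atTop.comp h1).const_mul_atTop hε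
    refine squeeze_zero' (Eventually.of_forall fun k => ?_) ?_
      (Real.tendsto_exp_neg_atTop_nhds_zero.comp hlog)
    · rw [unitDegree_eq_adjustedSoliton]
      exact bpError_nonneg (adjustedSoliton_nonneg le_rfl zero_le_one) _ _ _
    · filter_upwards [hn, hpos] with k hn hδ
      have hk : (0 : ℝ) < k := by exact_mod_cast hδ.1
      refine (bpError_unitDegree_le hδ.1 hδ.2).trans ?_
      have h1 : (1 + ε) * Real.log (1 / δ k) ≤ n k / k := by
        rw [le_div_iff₀ hk]; linarith
      have h2 : Real.exp (-Real.log (1 / δ k)) = δ k := by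
        rw [one_div, Real.log_inv, neg_neg, Real.exp_log hδ.2]
      rw [div_le_iff₀ hδ.2, Function.comp_apply]
      have h3 : Real.exp (-(n k / k)) ≤
          Real.exp (-(ε * Real.log (1 / δ k))) * Real.exp (-Real.log (1 / δ k)) := by
        rw [← Real.exp_add]
        exact Real.exp_le_exp.2 (by linarith)
      rwa [h2] at h3
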